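/- Fix an integer $d\ge 1$, real numbers $\alpha>0$, $0<\gamma\le d$, $0<r<\infty$ and $s_*>0$. For $f\in L^2(\mathbb R^d)$ with compactly supported Fourier transform $\widehat f(\xi)=\int e^{-ix\cdot\xi}f(x)\,dx$ (understood in the $L^2$ sense) write $$e^{it(-\Delta)^{\alpha/2}}f(x)=(2\pi)^{-d}\int_{\mathbb R^d}e^{i(x\cdot\xi+t|\xi|^\alpha)}\widehat f(\xi)\,d\xi ,\qquad x\in\mathbb R^d,\ t\in\mathbb R,$$ and let $\mathbb A_R=\{\xi\in\mathbb R^d: R\le|\xi|\le 2R\}$ and $B(x,\rho)=\{y\in\mathbb R^d:|x-y|<\rho\}$. A nonnegative Borel measure $\mu$ on $\mathbb R^d$ is called $\gamma$-dimensional if there is a constant $C_\mu<\infty$ with $\mu(B(x,\rho))\le C_\mu\rho^\gamma$ for all $x\in\mathbb R^d$ and $\rho>0$; the infimum of such constants $C_\mu \geq 0$ is denoted by $\langle\mu\rangle_\gamma$. Suppose that there is a constant $C_0>0$ such that $$\Big\|\sup_{0<t\le1}|e^{it(-\Delta)^{\alpha/2}}f|\Big\|_{L^2(B(0,1),d\mu)}\le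 C_0\,R^{\frac{d-\gamma}2+s_*}\langle\mu\rangle_\gamma^{1/2}\|f\|_{L^2(\mathbb R^d)}$$ for all $R\ge1$, all $\gamma$-dimensional measures $\mu$ on $\mathbb R^d$ and all $f\in L^2(\mathbb R^d)$ with $\operatorname{supp}\widehat f\subset\mathbb A_R$. Let $$\tilde s_*=\frac{r\alpha}{r\min\{\alpha,1\}+2s_*}\,s_* .$$ Then, for every real sequence $\{t_n\}_{n\in\mathbb N}$ in $\ell^{r,\infty}(\mathbb N)$, that is, with $\sup_{\delta>0}\delta^r\,\#\{n\in\mathbb N:|t_n|\ge\delta\}<\infty$, there is a constant $C>0$ such that $$\Big\|\sup_{n}|e^{it_n(-\Delta)^{\alpha/2}}f|\Big\|_{L^2(B(0,1),d\mu)}\le C\,R^{\frac{d-\gamma}2+s}\langle\mu\rangle_\gamma^{1/2}\|f\|_{L^2(\mathbb R^d)}$$ for all $s\ge\min\{s_*,\tilde s_*\}$, all $R\ge1$, all $\gamma$-dimensional measures $\mu$ on $\mathbb R^d$ and all $f\in L^2(\mathbb R^d)$ with $\operatorname{supp}\widehat f\subset\mathbb A_R$. -/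

import Mathlib

open MeasureTheory Metric
open scoped ENNReal NNReal FourierTransform

noncomputable section

/-- The space `L²(ℝ^d)` of complex-valued functions (Lebesgue measure). -/
abbrev L2Space (d : ℕ) : Type :=
  Lp ℂ 2 (volume : Measure (EuclideanSpace ℝ (Fin d)))

/-- The Fourier transform on `L²(ℝ^d)` normalized as `f̂(ξ) = ∫ e^{-i x·ξ} f(x) dx`.
Mathlib's `𝓕` on `L²` has the kernel `e^{-2πi x·ξ}`, hence the rescaling of the variable by
`(2π)⁻¹`. As usual for `L²`, it is determined up to almost everywhere equality. -/
def fourierHat {d : ℕ} (f : L2Space d) (ξ : EuclideanSpace ℝ (Fin d)) : ℂ :=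
  (𝓕 f : L2Space d) ((2 * Real.pi)⁻¹ • ξ)

/-- `e^{it(-Δ)^{α/2}} f (x) = (2π)^{-d} ∫ e^{i(x·ξ + t|ξ|^α)} f̂(ξ) dξ`, at every point `x`.
For `f ∈ L²` with compactly supported Fourier transform the integral converges absolutely. -/
def schrodinger {d : ℕ} (α t : ℝ) (f : L2Space d) (x : EuclideanSpace ℝ (Fin d)) : ℂ :=
  (((2 * Real.pi) ^ d)⁻¹ : ℝ) *
    ∫ ξ : EuclideanSpace ℝ (Fin d),
      Complex.exp (Complex.I * ((inner ℝ x ξ + t * ‖ξ‖ ^ α : ℝ) : ℂ)) * fourierHat f ξ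

/-- The annulus `A_R = {ξ : R ≤ |ξ| ≤ 2R}`. -/
def annulus (d : ℕ) (R : ℝ) : Set (EuclideanSpace ℝ (Fin d)) :=
  {ξ | R ≤ ‖ξ‖ ∧ ‖ξ‖ ≤ 2 * R}

/-- The Fourier transform of `f` is supported in the (closed) annulus `A_R`, that is, it vanishes
almost everywhere off `A_R`. -/
def FourierSupportedIn {d : ℕ} (f : L2Space d) (R : ℝ) : Prop :=
  ∀ᵐ ξ : EuclideanSpace ℝ (Fin d), ξ ∉ annulus d R → fourierHat f ξ = 0

/-- The constants `C ≥ 0` such that `μ(B(x,ρ)) ≤ C ρ^γ` for all `x ∈ ℝ^d` and `ρ > 0`. -/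
def ballConstants {d : ℕ} (γ : ℝ) (μ : Measure (EuclideanSpace ℝ (Fin d))) : Set ℝ :=
  {C | 0 ≤ C ∧ ∀ (x : EuclideanSpace ℝ (Fin d)) (ρ : ℝ), 0 < ρ →
    μ (ball x ρ) ≤ ENNReal.ofReal (C * ρ ^ γ)}

/-- The Borel measure `μ` on `ℝ^d` is `γ`-dimensional. -/
def IsDimensional {d : ℕ} (γ : ℝ) (μ : Measure (EuclideanSpace ℝ (Fin d))) : Prop :=
  (ballConstants γ μ).Nonempty

/-- `⟨μ⟩_γ`, the infimum of the admissible constants. -/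
def dimConst {d : ℕ} (γ : ℝ) (μ : Measure (EuclideanSpace ℝ (Fin d))) : ℝ :=
  sInf (ballConstants γ μ)

/-- The `L²(B(0,1), dμ)` norm of `x ↦ sup_{i} |e^{i t_i (-Δ)^{α/2}} f (x)|`, the supremum being
taken over a family of times, with values in `[0, ∞]`. -/
def maximalNorm {d : ℕ} {ι : Type} (α : ℝ) (t : ι → ℝ) (f : L2Space d)
    (μ : Measure (EuclideanSpace ℝ (Fin d))) : ℝ≥0∞ :=
  eLpNorm (fun x => ⨆ i, ‖schrodinger α (t i) f x‖ₑ) 2 (μ.restrict (ball 0 1))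

/-- `t ∈ ℓ^{r,∞}(ℕ)`: `sup_{δ>0} δ^r #{n : |t_n| ≥ δ} < ∞`. -/
def MemWeakEll (r : ℝ) (t : ℕ → ℝ) : Prop :=
  ⨆ (δ : ℝ) (_ : 0 < δ), ENNReal.ofReal (δ ^ r) * (({n : ℕ | δ ≤ |t n|}.encard : ℕ∞) : ℝ≥0∞) < ⊤

end

/-!
Dilating frequencies of size `R` to unit size turns the unit ball into a ball of radius `R`. At unit
frequency a wave travels a distance at most comparable to `N` during times `|t| ≤ N`, so a maximal
estimate on all balls of radius `N` over such times implies the global one: on each ball, a decaying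
weight centred there can be moved from the amplitude's kernel onto the initial datum at the cost of
replacing the amplitude by finitely many others, and the weights are then averaged over the centre.

Given a sequence in `ℓ^{r,∞}`, the times with `|t_n| < δ` are short times for some smaller scale
`R^κ`, where the global estimate applies with the loss `R^{κ s_*}`. Each of the `O(δ^{-r})` other
times is handled by the lossless fixed-time estimate. The exponent `κ s_* = s̃_*` comes from the
choice of `δ` that balances the two contributions.
-/

noncomputable section

section Extension

variable {E : Type*} [NormedAddCommGroup E] [InnerProductSpace ℝ E]

/-- The oscillating factor `e^{i(2π⟨x,ζ⟩ + tφ(ζ))}` of the propagator with phase `φ`, in Mathlib's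
normalization of the Fourier transform. -/
def planeWave (φ : E → ℝ) (x : E) (t : ℝ) (ζ : E) : ℂ :=
  Complex.exp (((2 * Real.pi * inner ℝ x ζ + t * φ ζ : ℝ) : ℂ) * Complex.I)

variable {φ : E → ℝ}

lemma norm_planeWave (x : E) (t : ℝ) (ζ : E) : ‖planeWave φ x t ζ‖ = 1 :=
  Complex.norm_exp_ofReal_mul_I _

lemma planeWave_add (x y : E) (t s : ℝ) (ζ : E) :
    planeWave φ (x + y) (t + s) ζ = planeWave φ x t ζ * planeWave φ y s ζ := by
  simp only [planeWave, ← Complex.exp_add, inner_add_left]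
  push_cast
  ring_nf

lemma continuous_planeWave_left (t : ℝ) (ζ : E) : Continuous fun x => planeWave φ x t ζ := by
  unfold planeWave
  fun_prop

variable [MeasurableSpace E]

lemma eLpNorm_planeWave_mul (x : E) (t : ℝ) (g : E → ℂ) (p : ℝ≥0∞) (μ : Measure E) :
    eLpNorm (fun ζ => planeWave φ x t ζ * g ζ) p μ = eLpNorm g p μ :=
  eLpNorm_congr_norm_ae <| .of_forall fun ζ => by rw [norm_mul, norm_planeWave, one_mul]

variable [BorelSpace E]

lemma measurable_planeWave (hφ : Measurable φ) (x : E) (t : ℝ) : Measurable (planeWave φ x t) := by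
  have : Measurable fun ζ => inner ℝ x ζ := (by fun_prop : Continuous _).measurable
  unfold planeWave
  fun_prop

lemma memLp_planeWave_mul (hφ : Measurable φ) (x : E) (t : ℝ) {g : E → ℂ} {p : ℝ≥0∞}
    {μ : Measure E} (hg : MemLp g p μ) : MemLp (fun ζ => planeWave φ x t ζ * g ζ) p μ :=
  ⟨(measurable_planeWave hφ x t).aestronglyMeasurable.mul hg.1,
    (eLpNorm_planeWave_mul x t g p μ).trans_lt hg.2⟩

lemma integrable_planeWave_mul (hφ : Measurable φ) (x : E) (t : ℝ) {g : E → ℂ} {μ : Measure E}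
    (hg : Integrable g μ) : Integrable (fun ζ => planeWave φ x t ζ * g ζ) μ :=
  memLp_one_iff_integrable.1 (memLp_planeWave_mul hφ x t (memLp_one_iff_integrable.2 hg))

variable [FiniteDimensional ℝ E]

/-- The extension operator `g ↦ ∫ e^{i(2π⟨x,ζ⟩ + tφ(ζ))} g(ζ) dζ` of the graph of `φ`, that is, the
propagator `e^{itφ(D)}` expressed on the frequency side. -/
def extension (φ : E → ℝ) (g : E → ℂ) (x : E) (t : ℝ) : ℂ :=
  ∫ ζ, planeWave φ x t ζ * g ζ

lemma extension_congr {g h : E → ℂ} (hgh : g =ᵐ[volume] h) : extension φ g = extension φ h := by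
  funext x t
  exact integral_congr_ae (hgh.mono fun ζ hζ => by simp only [hζ])

lemma extension_planeWave_mul (y : E) (s : ℝ) (g : E → ℂ) (x : E) (t : ℝ) :
    extension φ (fun ζ => planeWave φ y s ζ * g ζ) x t = extension φ g (x + y) (t + s) := by
  simp only [extension, planeWave_add, mul_assoc]

lemma extension_add (hφ : Measurable φ) {g h : E → ℂ} (hg : Integrable g) (hh : Integrable h)
    (x : E) (t : ℝ) : extension φ (g + h) x t = extension φ g x t + extension φ h x t := by
  simp only [extension, Pi.add_apply, mul_add]
  exact integral_add (integrable_planeWave_mul hφ x t hg) (integrable_planeWave_mul hφ x t hh)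

lemma continuous_extension (hφ : Measurable φ) {g : E → ℂ} (hg : Integrable g) (t : ℝ) :
    Continuous fun x => extension φ g x t :=
  continuous_of_dominated (bound := fun ζ => ‖g ζ‖)
    (fun x => (integrable_planeWave_mul hφ x t hg).aestronglyMeasurable)
    (fun x => .of_forall fun ζ => by rw [norm_mul, norm_planeWave, one_mul]) hg.norm
    (.of_forall fun ζ => (continuous_planeWave_left t ζ).mul continuous_const)

lemma measurable_biSup_enorm_extension_sq (hφ : Measurable φ) {g : E → ℂ} (hg : Integrable g)
    (T : Set ℝ) : Measurable fun x => ⨆ t ∈ T, ‖extension φ g x t‖ₑ ^ 2 :=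
  (lowerSemicontinuous_biSup fun t _ =>
    ((ENNReal.continuous_pow 2).comp
      (continuous_extension hφ hg t).enorm).lowerSemicontinuous).measurable

end Extension

section MaximalBound

variable {E : Type*} [NormedAddCommGroup E] [InnerProductSpace ℝ E] [MeasurableSpace E]
  [BorelSpace E] [FiniteDimensional ℝ E]

/-- `∫ sup_{t ∈ T} |e^{itφ(D)} ǧ|² dμ`, the square of the maximal `L²` norm over the times `T`. -/
def maximalSq (φ : E → ℝ) (T : Set ℝ) (g : E → ℂ) (μ : Measure E) : ℝ≥0∞ :=
  ∫⁻ x, ⨆ t ∈ T, ‖extension φ g x t‖ₑ ^ 2 ∂μ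

/-- The maximal estimate over the times `T`, with the squared constant `A`, for frequency functions
`g` that vanish off `S`. Integrability of `g` is required because the integral in `extension` has
the junk value `0` without it. -/
def MaximalBound (φ : E → ℝ) (T : Set ℝ) (μ : Measure E) (S : Set E) (A : ℝ≥0∞) : Prop :=
  ∀ g : E → ℂ, Integrable g → MemLp g 2 → (∀ᵐ ζ, ζ ∉ S → g ζ = 0) →
    maximalSq φ T g μ ≤ A * eLpNorm g 2 ^ 2

variable {φ : E → ℝ} {T T' : Set ℝ} {μ μ' : Measure E} {S S' : Set E} {A A' : ℝ≥0∞}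

lemma maximalSq_mono {g : E → ℂ} (hT : T ⊆ T') (hμ : μ ≤ μ') :
    maximalSq φ T g μ ≤ maximalSq φ T' g μ' :=
  lintegral_mono' hμ fun _ => biSup_mono hT

lemma maximalSq_union_le (hφ : Measurable φ) {g : E → ℂ} (hg : Integrable g) :
    maximalSq φ (T ∪ T') g μ ≤ maximalSq φ T g μ + maximalSq φ T' g μ := by
  simp only [maximalSq]
  rw [← lintegral_add_left (measurable_biSup_enorm_extension_sq hφ hg T)]
  refine lintegral_mono fun x => ?_
  rw [iSup_union]
  exact sup_le le_self_add le_add_self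

lemma enorm_add_sq_le {F : Type*} [TopologicalSpace F] [ESeminormedAddMonoid F] (a b : F) :
    ‖a + b‖ₑ ^ 2 ≤ 2 * (‖a‖ₑ ^ 2 + ‖b‖ₑ ^ 2) := by
  refine (pow_le_pow_left' (enorm_add_le a b) 2).trans ?_
  have h := ENNReal.rpow_add_le_mul_rpow_add_rpow ‖a‖ₑ ‖b‖ₑ one_le_two
  norm_num at h
  exact h

lemma maximalSq_add_le (hφ : Measurable φ) {g h : E → ℂ} (hg : Integrable g)
    (hh : Integrable h) :
    maximalSq φ T (g + h) μ ≤ 2 * (maximalSq φ T g μ + maximalSq φ T h μ) := by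
  simp only [maximalSq]
  rw [← lintegral_add_left (measurable_biSup_enorm_extension_sq hφ hg T),
    ← lintegral_const_mul' _ _ ENNReal.ofNat_ne_top]
  refine lintegral_mono fun x => iSup₂_le fun t ht => ?_
  rw [extension_add hφ hg hh]
  refine (enorm_add_sq_le _ _).trans ?_
  gcongr
  · exact le_biSup (fun t => ‖extension φ g x t‖ₑ ^ 2) ht
  · exact le_biSup (fun t => ‖extension φ h x t‖ₑ ^ 2) ht

lemma maximalSq_planeWave_mul_time (s : ℝ) (g : E → ℂ) :
    maximalSq φ T (fun ζ => planeWave φ 0 s ζ * g ζ) μ = maximalSq φ ((· + s) '' T) g μ := by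
  simp only [maximalSq, iSup_image, extension_planeWave_mul, add_zero]

lemma maximalSq_planeWave_mul_space (y : E) (g : E → ℂ) :
    maximalSq φ T (fun ζ => planeWave φ y 0 ζ * g ζ) (μ.map (· - y)) = maximalSq φ T g μ := by
  simp only [maximalSq, extension_planeWave_mul, add_zero]
  rw [(measurableEmbedding_subRight y).lintegral_map]
  simp only [sub_add_cancel]

namespace MaximalBound

lemma mono (hT : T ⊆ T') (hμ : μ ≤ μ') (hS : S ⊆ S') (hA : A' ≤ A)
    (h : MaximalBound φ T' μ' S' A') : MaximalBound φ T μ S A := fun g hg hg2 hgS =>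
  (maximalSq_mono hT hμ).trans <|
    (h g hg hg2 (hgS.mono fun _ hζ hζS => hζ fun h => hζS (hS h))).trans (by gcongr)

lemma planeWave_mul (hφ : Measurable φ) (h : MaximalBound φ T μ S A) (x : E) (s : ℝ) {g : E → ℂ}
    (hg : Integrable g) (hg2 : MemLp g 2) (hgS : ∀ᵐ ζ, ζ ∉ S → g ζ = 0) :
    maximalSq φ T (fun ζ => planeWave φ x s ζ * g ζ) μ ≤ A * eLpNorm g 2 ^ 2 := by
  rw [← eLpNorm_planeWave_mul (φ := φ) x s g]
  refine h _ (integrable_planeWave_mul hφ x s hg) (memLp_planeWave_mul hφ x s hg2) ?_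
  filter_upwards [hgS] with ζ hζ hζS
  rw [hζ hζS, mul_zero]

lemma image_add_const (hφ : Measurable φ) (h : MaximalBound φ T μ S A) (s : ℝ) :
    MaximalBound φ ((· + s) '' T) μ S A := fun g hg hg2 hgS =>
  maximalSq_planeWave_mul_time s g ▸ h.planeWave_mul hφ 0 s hg hg2 hgS

lemma of_map_sub_const (hφ : Measurable φ) {y : E} (h : MaximalBound φ T (μ.map (· - y)) S A) :
    MaximalBound φ T μ S A := fun g hg hg2 hgS =>
  maximalSq_planeWave_mul_space y g ▸ h.planeWave_mul hφ y 0 hg hg2 hgS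

lemma union_times (hφ : Measurable φ) (h : MaximalBound φ T μ S A)
    (h' : MaximalBound φ T' μ S A') : MaximalBound φ (T ∪ T') μ S (A + A') :=
  fun g hg hg2 hgS => (maximalSq_union_le hφ hg).trans <| by
    rw [add_mul]
    exact add_le_add (h g hg hg2 hgS) (h' g hg hg2 hgS)

lemma biUnion_times (hφ : Measurable φ) {ι : Type*} {F : Finset ι} {T : ι → Set ℝ}
    {A : ι → ℝ≥0∞} (h : ∀ i ∈ F, MaximalBound φ (T i) μ S (A i)) :
    MaximalBound φ (⋃ i ∈ F, T i) μ S (∑ i ∈ F, A i) := by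
  classical
  induction F using Finset.induction_on with
  | empty => intro g _ _ _; simp [maximalSq]
  | insert i F hi ih =>
    rw [Finset.set_biUnion_insert, Finset.sum_insert hi]
    exact (h i (F.mem_insert_self i)).union_times hφ
      (ih fun j hj => h j (Finset.mem_insert_of_mem hj))

lemma union_support (hφ : Measurable φ) (hS : MeasurableSet S) (h : MaximalBound φ T μ S A)
    (h' : MaximalBound φ T μ S' A') : MaximalBound φ T μ (S ∪ S') (2 * (A + A')) := by
  intro g hg hg2 hgS
  have h₁ := h (S.indicator g) (hg.indicator hS) (hg2.indicator hS)
    (.of_forall fun ζ hζ => Set.indicator_of_notMem hζ g)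
  have h₂ := h' (Sᶜ.indicator g) (hg.indicator hS.compl) (hg2.indicator hS.compl) <| by
    filter_upwards [hgS] with ζ hζ hζS'
    by_cases hζS : ζ ∈ S
    · exact Set.indicator_of_notMem (Set.notMem_compl_iff.2 hζS) g
    · rw [Set.indicator_of_mem (Set.mem_compl hζS), hζ fun h => h.elim hζS hζS']
  have hsum := maximalSq_add_le (T := T) (μ := μ) hφ (hg.indicator hS) (hg.indicator hS.compl)
  rw [Set.indicator_self_add_compl] at hsum
  refine hsum.trans ?_
  rw [mul_assoc, add_mul]
  gcongr 2 * (?_ + ?_)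
  · exact h₁.trans (by gcongr; exact eLpNorm_indicator_le g)
  · exact h₂.trans (by gcongr; exact eLpNorm_indicator_le g)

end MaximalBound

end MaximalBound

section DecayWeight

variable {E : Type*} [NormedAddCommGroup E]

/-- The weight `(1 + |x|²)^{-m}`. -/
def decayWeight (m : ℕ) (x : E) : ℝ :=
  ((1 + ‖x‖ ^ 2) ^ m)⁻¹

lemma decayWeight_nonneg (m : ℕ) (x : E) : 0 ≤ decayWeight m x := by
  unfold decayWeight
  positivity

lemma decayWeight_le_one (m : ℕ) (x : E) : decayWeight m x ≤ 1 :=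
  inv_le_one_of_one_le₀ (one_le_pow₀ (le_add_of_nonneg_right (sq_nonneg ‖x‖)))

lemma continuous_decayWeight (m : ℕ) : Continuous (decayWeight m : E → ℝ) := by
  unfold decayWeight
  exact Continuous.inv₀ (by fun_prop) fun x => by positivity

end DecayWeight

section FourierWeight

open SchwartzMap LineDeriv Module
open scoped SchwartzMap

variable {E : Type*} [NormedAddCommGroup E] [InnerProductSpace ℝ E] [FiniteDimensional ℝ E]

/-- The operator `h ↦ (2πN)⁻¹(-i∂_v - 2π⟨a,v⟩)h`, which is multiplication by `⟨y - a, v⟩ / N` on the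
Fourier side. -/
def shiftedDeriv (N : ℝ) (a v : E) (h : 𝓢(E, ℂ)) : 𝓢(E, ℂ) :=
  (2 * Real.pi * N : ℂ)⁻¹ • (-Complex.I • ∂_{v} h - (2 * Real.pi * inner ℝ a v : ℂ) • h)

/-- The operator which is multiplication by `1 + |(y - a) / N|²` on the Fourier side. -/
def weightOperator (N : ℝ) (a : E) (h : 𝓢(E, ℂ)) : 𝓢(E, ℂ) :=
  h + ∑ i, shiftedDeriv N a (stdOrthonormalBasis ℝ E i)
    (shiftedDeriv N a (stdOrthonormalBasis ℝ E i) h)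

variable [MeasurableSpace E] [BorelSpace E]

lemma fourier_shiftedDeriv (N : ℝ) (a v : E) (h : 𝓢(E, ℂ)) (y : E) :
    (𝓕 (shiftedDeriv N a v h)) y = ((inner ℝ (y - a) v / N : ℝ) : ℂ) * (𝓕 h) y := by
  have hlin : 𝓕 (shiftedDeriv N a v h) = (2 * Real.pi * N : ℂ)⁻¹ •
      (-Complex.I • 𝓕 (∂_{v} h) - (2 * Real.pi * inner ℝ a v : ℂ) • 𝓕 h) := by
    simp only [shiftedDeriv, ← FourierTransform.fourierCLM_apply (R := ℂ), map_smul, map_sub]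
  rw [hlin, fourier_lineDerivOp_eq]
  simp only [smul_apply, sub_apply, smul_eq_mul]
  rw [smulLeftCLM_apply_apply (by fun_prop), Complex.real_smul, inner_sub_left]
  push_cast
  field_simp
  linear_combination (-(inner ℝ y v / N : ℂ) * (𝓕 h) y) * Complex.I_sq

lemma fourier_weightOperator (N : ℝ) (a : E) (h : 𝓢(E, ℂ)) (y : E) :
    (𝓕 (weightOperator N a h)) y = ((1 + ‖N⁻¹ • (y - a)‖ ^ 2 : ℝ) : ℂ) * (𝓕 h) y := by
  have hlin : 𝓕 (weightOperator N a h) = 𝓕 h + ∑ i, 𝓕 (shiftedDeriv N a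
      (stdOrthonormalBasis ℝ E i) (shiftedDeriv N a (stdOrthonormalBasis ℝ E i) h)) := by
    simp only [weightOperator, ← FourierTransform.fourierCLM_apply (R := ℂ), map_add, map_sum]
  rw [hlin, ← (stdOrthonormalBasis ℝ E).sum_sq_norm_inner_left]
  simp only [add_apply, sum_apply, fourier_shiftedDeriv, real_inner_smul_left, Real.norm_eq_abs,
    sq_abs]
  push_cast
  rw [add_mul, one_mul, Finset.sum_mul]
  congr 1
  exact Finset.sum_congr rfl fun i _ => by ring

lemma fourier_iterate_weightOperator (N : ℝ) (a : E) (m : ℕ) (h : 𝓢(E, ℂ)) (y : E) :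
    (𝓕 ((weightOperator N a)^[m] h)) y =
      (((decayWeight m (N⁻¹ • (y - a)))⁻¹ : ℝ) : ℂ) * (𝓕 h) y := by
  induction m with
  | zero => simp [decayWeight]
  | succ m ih =>
    rw [Function.iterate_succ_apply', fourier_weightOperator, ih, ← mul_assoc,
      ← Complex.ofReal_mul, decayWeight, decayWeight, inv_inv, inv_inv, pow_succ' _ m]

lemma eLpNorm_fourier (u : Lp ℂ 2 (volume : Measure E)) :
    eLpNorm (𝓕 u : Lp ℂ 2 (volume : Measure E)) 2 = eLpNorm u 2 := by
  rw [← Lp.enorm_def, ← Lp.enorm_def, enorm_eq_iff_norm_eq, Lp.norm_fourier_eq]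

lemma exists_fourier_ae_eq {g : E → ℂ} (hg : MemLp g 2) : ∃ f : Lp ℂ 2 (volume : Measure E),
    (𝓕 f : Lp ℂ 2 (volume : Measure E)) =ᵐ[volume] g := by
  refine ⟨𝓕⁻ hg.toLp, ?_⟩
  rw [FourierTransform.fourier_fourierInv_eq]
  exact hg.coeFn_toLp

lemma integral_schwartz_mul_fourier (h : 𝓢(E, ℂ)) (u : Lp ℂ 2 (volume : Measure E)) :
    ∫ ζ, h ζ * (𝓕 u : Lp ℂ 2 (volume : Measure E)) ζ = ∫ y, (𝓕 h) y * u y := by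
  have hT := DFunLike.congr_fun (Lp.fourier_toTemperedDistribution_eq u) h
  simp only [TemperedDistribution.fourier_apply, Lp.toTemperedDistribution_apply,
    smul_eq_mul] at hT
  exact hT.symm

/-- Dividing `u` by the weight is compensated by applying the weight operator to the test
function. -/
lemma integral_schwartz_mul_fourier_eq_weightOperator (N : ℝ) (a : E) (m : ℕ)
    (h : 𝓢(E, ℂ)) {f u : Lp ℂ 2 (volume : Measure E)}
    (hu : u =ᵐ[volume] fun z => (decayWeight m (N⁻¹ • (z - a)) : ℂ) * f z) :
    ∫ ζ, h ζ * (𝓕 f : Lp ℂ 2 (volume : Measure E)) ζ =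
      ∫ ζ, (weightOperator N a)^[m] h ζ * (𝓕 u : Lp ℂ 2 (volume : Measure E)) ζ := by
  rw [integral_schwartz_mul_fourier, integral_schwartz_mul_fourier]
  refine integral_congr_ae ?_
  filter_upwards [hu] with z hz
  have hw : (decayWeight m (N⁻¹ • (z - a)) : ℂ) ≠ 0 := by
    rw [decayWeight]
    exact_mod_cast (by positivity)
  rw [hz, fourier_iterate_weightOperator, Complex.ofReal_inv]
  generalize (decayWeight m (N⁻¹ • (z - a)) : ℂ) = w at hw ⊢
  field_simp

end FourierWeight

section Amplitude

open scoped ContDiff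

variable {E : Type*} [NormedAddCommGroup E] [InnerProductSpace ℝ E]

/-- Smooth amplitudes with compact support inside `U`. -/
structure IsAmplitude (U : Set E) (B : E → ℂ) : Prop where
  contDiff : ContDiff ℝ ∞ B
  hasCompactSupport : HasCompactSupport B
  tsupport_subset : tsupport B ⊆ U

variable {U : Set E} {B : E → ℂ}

namespace IsAmplitude

lemma mul (hB : IsAmplitude U B) {u : E → ℂ} (hu : ∀ ζ ∈ U, ContDiffAt ℝ ∞ u ζ) :
    IsAmplitude U fun ζ => u ζ * B ζ := by
  have hs : tsupport (fun ζ => u ζ * B ζ) ⊆ tsupport B := tsupport_mul_subset_right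
  refine ⟨contMDiff_iff_contDiff.1 (contMDiff_of_tsupport fun ζ hζ =>
    contMDiffAt_iff_contDiffAt.2 ?_), hB.hasCompactSupport.mul_left, hs.trans hB.tsupport_subset⟩
  exact (hu ζ (hB.tsupport_subset (hs hζ))).mul hB.contDiff.contDiffAt

lemma fderiv_apply (hB : IsAmplitude U B) (v : E) : IsAmplitude U fun ζ => fderiv ℝ B ζ v where
  contDiff := (hB.contDiff.fderiv_right (by norm_num)).clm_apply contDiff_const
  hasCompactSupport := hB.hasCompactSupport.fderiv_apply ℝ v
  tsupport_subset := (tsupport_fderiv_apply_subset ℝ v).trans hB.tsupport_subset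

lemma exists_eq_one [FiniteDimensional ℝ E] {K : Set E} (hK : IsCompact K) (hU : IsOpen U)
    (hKU : K ⊆ U) : ∃ B : E → ℂ, IsAmplitude U B ∧ ∀ ζ ∈ K, B ζ = 1 := by
  obtain ⟨L, hL, hKL, hLU⟩ := exists_compact_between hK hU hKU
  obtain ⟨f, hf0, hf1, -⟩ := exists_contMDiffMap_zero_one_of_isClosed
    (modelWithCornersSelf ℝ E) (n := (⊤ : ℕ∞)) isOpen_interior.isClosed_compl hK.isClosed
    (Set.disjoint_compl_left_iff_subset.2 hKL)
  have hsupp : tsupport (fun ζ => (f ζ : ℂ)) ⊆ L := by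
    refine closure_minimal (fun ζ hζ => ?_) hL.isClosed
    by_contra hζL
    have : f ζ = 0 := hf0 fun h => hζL (interior_subset h)
    simp [this] at hζ
  exact ⟨fun ζ => (f ζ : ℂ), ⟨Complex.ofRealCLM.contDiff.comp f.contMDiff.contDiff,
    hL.of_isClosed_subset (isClosed_tsupport _) hsupp, hsupp.trans hLU⟩,
    fun ζ hζ => by simp [show f ζ = 1 from hf1 hζ]⟩

end IsAmplitude

variable {φ : E → ℝ}

lemma hasFDerivAt_planeWave {ζ : E} (hφ : DifferentiableAt ℝ φ ζ) (x : E) (t : ℝ) :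
    HasFDerivAt (planeWave φ x t) (planeWave φ x t ζ • Complex.ofRealCLM.smulRight Complex.I ∘L
      ((2 * Real.pi) • innerSL ℝ x + t • fderiv ℝ φ ζ)) ζ := by
  have hphase : HasFDerivAt (fun η => 2 * Real.pi * inner ℝ x η + t * φ η)
      ((2 * Real.pi) • innerSL ℝ x + t • fderiv ℝ φ ζ) ζ :=
    ((innerSL ℝ x).hasFDerivAt.const_mul _).add (hφ.hasFDerivAt.const_mul t)
  exact ((Complex.ofRealCLM.smulRight Complex.I).hasFDerivAt.comp ζ hphase).cexp

lemma contDiffAt_planeWave {ζ : E} (hφ : ContDiffAt ℝ ∞ φ ζ) (x : E) (t : ℝ) :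
    ContDiffAt ℝ ∞ (planeWave φ x t) ζ := by
  have hphase : ContDiffAt ℝ ∞ (fun η => 2 * Real.pi * inner ℝ x η + t * φ η) ζ :=
    (contDiffAt_const.mul (contDiffAt_const.inner ℝ contDiffAt_id)).add (contDiffAt_const.mul hφ)
  exact ((Complex.ofRealCLM.contDiff.contDiffAt.comp ζ hphase).mul contDiffAt_const).cexp

lemma fderiv_planeWave_mul (hB : IsAmplitude U B) (hφ : ∀ ζ ∈ U, ContDiffAt ℝ ∞ φ ζ) (x : E)
    (t : ℝ) (v ζ : E) :
    fderiv ℝ (fun η => planeWave φ x t η * B η) ζ v = planeWave φ x t ζ * (fderiv ℝ B ζ v +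
      Complex.I * ((2 * Real.pi * inner ℝ x v + t * fderiv ℝ φ ζ v : ℝ) : ℂ) * B ζ) := by
  by_cases hζ : ζ ∈ tsupport B
  · have hw := hasFDerivAt_planeWave
      ((hφ ζ (hB.tsupport_subset hζ)).differentiableAt (by norm_num)) x t
    rw [(hw.fun_mul (hB.contDiff.differentiable (by norm_num) ζ).hasFDerivAt).fderiv]
    simp only [add_apply, smul_apply, smul_eq_mul, ContinuousLinearMap.comp_apply,
      ContinuousLinearMap.smulRight_apply, innerSL_apply_apply, Complex.ofRealCLM_apply]
    push_cast
    ring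
  · have hB0 : B =ᶠ[nhds ζ] 0 := notMem_tsupport_iff_eventuallyEq.1 hζ
    have hwB0 : (fun η => planeWave φ x t η * B η) =ᶠ[nhds ζ] 0 := by
      filter_upwards [hB0] with η hη
      simp [hη]
    rw [hwB0.fderiv_eq, hB0.fderiv_eq, hB0.eq_of_nhds]
    simp

end Amplitude

section WaveSum

open SchwartzMap LineDeriv
open scoped SchwartzMap ContDiff

variable {E : Type*} [NormedAddCommGroup E]

/-- The parameters of a wave at the space-time point `(pos, time)`, observed from the ball
`ball center radius`. -/
structure WaveParam (E : Type*) where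
  radius : ℝ
  center : E
  pos : E
  time : ℝ

/-- The position lies in the ball and the time does not exceed the radius. -/
structure WaveParam.Admissible (p : WaveParam E) : Prop where
  one_le_radius : 1 ≤ p.radius
  norm_pos_sub_center_le : ‖p.pos - p.center‖ ≤ p.radius
  abs_time_le : |p.time| ≤ p.radius

/-- Coefficients bounded uniformly over the admissible parameters. -/
def IsBoundedCoeff (c : WaveParam E → ℂ) : Prop :=
  ∃ K : ℝ≥0, ∀ p, p.Admissible → ‖c p‖₊ ≤ K

lemma IsBoundedCoeff.mul_div_radius {c : WaveParam E → ℂ} (hc : IsBoundedCoeff c)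
    {a : WaveParam E → ℂ} {M : ℝ≥0} (ha : ∀ p, p.Admissible → ‖a p‖ ≤ M * p.radius) :
    IsBoundedCoeff fun p => (2 * Real.pi * p.radius : ℂ)⁻¹ * a p * c p := by
  obtain ⟨K, hK⟩ := hc
  refine ⟨M * K, fun p hp => ?_⟩
  rw [nnnorm_mul]
  refine mul_le_mul' ?_ (hK p hp)
  have hpos : 0 < p.radius := zero_lt_one.trans_le hp.one_le_radius
  have hpi : 1 ≤ 2 * Real.pi := by linarith [Real.pi_gt_three]
  rw [← NNReal.coe_le_coe, coe_nnnorm, norm_mul, norm_inv, norm_mul, norm_mul, Complex.norm_real,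
    Complex.norm_real, Complex.norm_two, Real.norm_of_nonneg Real.pi_pos.le,
    Real.norm_of_nonneg hpos.le, inv_mul_le_iff₀ (by positivity)]
  refine (ha p hp).trans ?_
  rw [mul_comm]
  gcongr
  exact le_mul_of_one_le_left hpos.le hpi

variable [InnerProductSpace ℝ E]

/-- Families of Schwartz functions that are finite sums of plane waves with a fixed amplitude and a
bounded coefficient. -/
inductive IsWaveSum (φ : E → ℝ) (U : Set E) : (WaveParam E → 𝓢(E, ℂ)) → Prop
  | term {c : WaveParam E → ℂ} {B : E → ℂ} {h : WaveParam E → 𝓢(E, ℂ)} (hc : IsBoundedCoeff c)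
      (hB : IsAmplitude U B) (hh : ∀ p ζ, h p ζ = c p * (planeWave φ p.pos p.time ζ * B ζ)) :
      IsWaveSum φ U h
  | add {h₁ h₂ : WaveParam E → 𝓢(E, ℂ)} :
      IsWaveSum φ U h₁ → IsWaveSum φ U h₂ → IsWaveSum φ U fun p => h₁ p + h₂ p

variable {φ : E → ℝ} {U : Set E} {B : E → ℂ}

/-- An amplitude times a plane wave, as a Schwartz function. -/
def amplitudeWave (hφ : ∀ ζ ∈ U, ContDiffAt ℝ ∞ φ ζ) (hB : IsAmplitude U B) (p : WaveParam E) :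
    𝓢(E, ℂ) :=
  have hA := hB.mul (u := planeWave φ p.pos p.time) fun ζ hζ => contDiffAt_planeWave (hφ ζ hζ) _ _
  hA.hasCompactSupport.toSchwartzMap hA.contDiff

lemma amplitudeWave_apply (hφ : ∀ ζ ∈ U, ContDiffAt ℝ ∞ φ ζ) (hB : IsAmplitude U B)
    (p : WaveParam E) (ζ : E) :
    amplitudeWave hφ hB p ζ = planeWave φ p.pos p.time ζ * B ζ := rfl

lemma lineDeriv_amplitudeWave (hφ : ∀ ζ ∈ U, ContDiffAt ℝ ∞ φ ζ) (hB : IsAmplitude U B)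
    (p : WaveParam E) (v ζ : E) :
    (∂_{v} (amplitudeWave hφ hB p)) ζ = planeWave φ p.pos p.time ζ * (fderiv ℝ B ζ v +
      Complex.I * ((2 * Real.pi * inner ℝ p.pos v + p.time * fderiv ℝ φ ζ v : ℝ) : ℂ) * B ζ) := by
  rw [lineDerivOp_apply_eq_fderiv]
  exact fderiv_planeWave_mul hB hφ _ _ v ζ

lemma isWaveSum_smul_amplitudeWave (hφ : ∀ ζ ∈ U, ContDiffAt ℝ ∞ φ ζ) (hB : IsAmplitude U B)
    {c : WaveParam E → ℂ} (hc : IsBoundedCoeff c) :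
    IsWaveSum φ U fun p => c p • amplitudeWave hφ hB p :=
  .term hc hB fun _ _ => rfl

lemma isAmplitude_fderiv_phase_mul (hφ : ∀ ζ ∈ U, ContDiffAt ℝ ∞ φ ζ) (hB : IsAmplitude U B)
    (v : E) : IsAmplitude U fun ζ => (fderiv ℝ φ ζ v : ℂ) * B ζ :=
  hB.mul fun ζ hζ => Complex.ofRealCLM.contDiff.contDiffAt.comp ζ
    (((hφ ζ hζ).fderiv_right (by norm_num)).clm_apply contDiffAt_const)

lemma shiftedDeriv_smul_amplitudeWave (hφ : ∀ ζ ∈ U, ContDiffAt ℝ ∞ φ ζ) (hB : IsAmplitude U B)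
    (c : ℂ) (p : WaveParam E) (v : E) :
    shiftedDeriv p.radius p.center v (c • amplitudeWave hφ hB p) =
      ((2 * Real.pi * p.radius : ℂ)⁻¹ * -Complex.I * c) • amplitudeWave hφ (hB.fderiv_apply v) p +
      (((2 * Real.pi * p.radius : ℂ)⁻¹ * ((2 * Real.pi * inner ℝ (p.pos - p.center) v : ℝ) : ℂ) *
        c) • amplitudeWave hφ hB p +
      ((2 * Real.pi * p.radius : ℂ)⁻¹ * (p.time : ℂ) * c) •
        amplitudeWave hφ (isAmplitude_fderiv_phase_mul hφ hB v) p) := by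
  ext ζ
  simp only [shiftedDeriv, lineDerivOp_smul, smul_apply, sub_apply, add_apply, smul_eq_mul,
    lineDeriv_amplitudeWave, amplitudeWave_apply, inner_sub_left]
  push_cast
  linear_combination (-(2 * Real.pi * p.radius : ℂ)⁻¹ * c * planeWave φ p.pos p.time ζ *
    (2 * Real.pi * inner ℝ p.pos v + p.time * fderiv ℝ φ ζ v) * B ζ) * Complex.I_sq

namespace IsWaveSum

variable {h : WaveParam E → 𝓢(E, ℂ)}

lemma shiftedDeriv (hφ : ∀ ζ ∈ U, ContDiffAt ℝ ∞ φ ζ) (hh : IsWaveSum φ U h) (v : E) :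
    IsWaveSum φ U fun p => shiftedDeriv p.radius p.center v (h p) := by
  induction hh with
  | add _ _ ih₁ ih₂ =>
    convert ih₁.add ih₂ using 2 with p
    simp only [_root_.shiftedDeriv, lineDerivOp_add, smul_add, smul_sub]
    abel
  | @term c B h hc hB hh =>
    have hwave : h = fun p => c p • amplitudeWave hφ hB p := by
      ext p ζ
      exact hh p ζ
    simp only [hwave, shiftedDeriv_smul_amplitudeWave]
    refine .add (isWaveSum_smul_amplitudeWave hφ _ (hc.mul_div_radius (M := 1) fun p hp => ?_))
      (.add (isWaveSum_smul_amplitudeWave hφ _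
        (hc.mul_div_radius (M := 2 * NNReal.pi * ‖v‖₊) fun p hp => ?_))
      (isWaveSum_smul_amplitudeWave hφ _ (hc.mul_div_radius (M := 1) fun p hp => ?_)))
    · simpa using hp.one_le_radius
    · have hinner := (abs_real_inner_le_norm (p.pos - p.center) v).trans
        (mul_le_mul_of_nonneg_right hp.norm_pos_sub_center_le (norm_nonneg v))
      rw [Complex.norm_real, norm_mul, Real.norm_of_nonneg (by positivity)]
      refine (mul_le_mul_of_nonneg_left hinner (by positivity)).trans_eq ?_
      push_cast
      simp only [NNReal.coe_real_pi]
      ring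
    · simpa using hp.abs_time_le

variable [FiniteDimensional ℝ E]

lemma weightOperator (hφ : ∀ ζ ∈ U, ContDiffAt ℝ ∞ φ ζ) (hh : IsWaveSum φ U h) :
    IsWaveSum φ U fun p => weightOperator p.radius p.center (h p) := by
  unfold _root_.weightOperator
  generalize (Finset.univ : Finset (Fin (Module.finrank ℝ E))) = F
  induction F using Finset.induction_on with
  | empty => simpa using hh
  | insert i F hi ih =>
    convert ih.add ((hh.shiftedDeriv hφ (stdOrthonormalBasis ℝ E i)).shiftedDeriv hφ
      (stdOrthonormalBasis ℝ E i)) using 2 with p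
    rw [Finset.sum_insert hi]
    abel

lemma iterate_weightOperator (hφ : ∀ ζ ∈ U, ContDiffAt ℝ ∞ φ ζ) (hh : IsWaveSum φ U h) (m : ℕ) :
    IsWaveSum φ U fun p => (_root_.weightOperator p.radius p.center)^[m] (h p) := by
  induction m with
  | zero => exact hh
  | succ m ih =>
    simp only [Function.iterate_succ_apply']
    exact ih.weightOperator hφ

end IsWaveSum

end WaveSum

section Averaging

open Module

variable {E : Type*} [NormedAddCommGroup E] [InnerProductSpace ℝ E] [MeasurableSpace E]
  [BorelSpace E] [FiniteDimensional ℝ E]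

lemma eLpNorm_two_sq {X F : Type*} [MeasurableSpace X] [TopologicalSpace F] [ContinuousENorm F]
    (f : X → F) (μ : Measure X) : eLpNorm f 2 μ ^ 2 = ∫⁻ x, ‖f x‖ₑ ^ 2 ∂μ := by
  have h := eLpNorm_nnreal_pow_eq_lintegral (p := 2) (f := f) (μ := μ) two_ne_zero
  norm_num at h
  exact h

lemma lintegral_comp_inv_smul {N : ℝ} (hN : 0 < N) (w : E → ℝ≥0∞) :
    ∫⁻ x, w (N⁻¹ • x) = ENNReal.ofReal (N ^ finrank ℝ E) * ∫⁻ x, w x := by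
  have hmap := (MeasurableEquiv.smul₀ N⁻¹ (inv_ne_zero hN.ne')).measurableEmbedding.lintegral_map
    (μ := (volume : Measure E)) w
  simp only [MeasurableEquiv.coe_smul₀] at hmap
  rw [← hmap, Measure.map_addHaar_smul _ (inv_ne_zero hN.ne'), lintegral_smul_measure,
    smul_eq_mul, inv_pow, inv_inv, abs_of_pos (by positivity)]

lemma lintegral_lintegral_dilate_mul {N : ℝ} (hN : 0 < N) {μ : Measure E} [SFinite μ]
    {w G : E → ℝ≥0∞} (hw : Measurable w) (hG : Measurable G) :
    ∫⁻ y, ∫⁻ x, w (N⁻¹ • (x - y)) * G x ∂μ =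
      ENNReal.ofReal (N ^ finrank ℝ E) * (∫⁻ x, w x) * ∫⁻ x, G x ∂μ := by
  rw [lintegral_lintegral_swap (by fun_prop), ← lintegral_const_mul _ hG]
  refine lintegral_congr fun x => ?_
  rw [lintegral_mul_const _ (by fun_prop),
    lintegral_sub_left_eq_self (fun z => w (N⁻¹ • z)) x, lintegral_comp_inv_smul hN]

lemma lintegral_setLIntegral_ball {N : ℝ} (hN : 0 < N) {μ : Measure E} [SFinite μ]
    {G : E → ℝ≥0∞} (hG : Measurable G) :
    ∫⁻ y, ∫⁻ x in ball y N, G x ∂μ =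
      ENNReal.ofReal (N ^ finrank ℝ E) * volume (ball (0 : E) 1) * ∫⁻ x, G x ∂μ := by
  rw [← lintegral_indicator_one measurableSet_ball, ← lintegral_lintegral_dilate_mul hN
    (measurable_one.indicator measurableSet_ball) hG]
  refine lintegral_congr fun y => ?_
  rw [← lintegral_indicator measurableSet_ball]
  refine lintegral_congr fun x => ?_
  have hmem : N⁻¹ • (x - y) ∈ ball (0 : E) 1 ↔ x ∈ ball y N := by
    rw [mem_ball_zero_iff, norm_smul, norm_inv, Real.norm_of_nonneg hN.le, inv_mul_lt_iff₀ hN,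
      mul_one, mem_ball_iff_norm]
  by_cases hx : x ∈ ball y N
  · simp [hx, hmem.2 hx]
  · simp [hx, mt hmem.1 hx]

lemma lintegral_eLpNorm_decayWeight_mul_sq (m : ℕ) {N : ℝ} (hN : 0 < N)
    (f : Lp ℂ 2 (volume : Measure E)) :
    ∫⁻ y, eLpNorm (fun z => (decayWeight m (N⁻¹ • (z - y)) : ℂ) * f z) 2 ^ 2 =
      ENNReal.ofReal (N ^ finrank ℝ E) * (∫⁻ x : E, ‖decayWeight m x‖ₑ ^ 2) *
        eLpNorm f 2 ^ 2 := by
  have hf : Measurable fun z => ‖f z‖ₑ ^ 2 :=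
    (Lp.stronglyMeasurable f).measurable.enorm.pow_const 2
  have hw : Measurable fun x : E => ‖decayWeight m x‖ₑ ^ 2 :=
    (continuous_decayWeight m).measurable.enorm.pow_const 2
  have henorm (a : ℝ) (z : ℂ) : ‖(a : ℂ) * z‖ₑ ^ 2 = ‖a‖ₑ ^ 2 * ‖z‖ₑ ^ 2 := by
    rw [← mul_pow, ← Complex.real_smul, enorm_smul]
  rw [eLpNorm_two_sq, ← lintegral_lintegral_dilate_mul hN hw hf]
  simp only [eLpNorm_two_sq, henorm]

lemma lintegral_decayWeight_sq_lt_top :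
    ∫⁻ x : E, ‖decayWeight (finrank ℝ E + 1) x‖ₑ ^ 2 < ⊤ := by
  have hint := integrable_rpow_neg_one_add_norm_sq (E := E) (μ := volume)
    (r := 4 * (finrank ℝ E + 1)) (by linarith)
  refine (lintegral_congr fun x => ?_).trans_lt hint.lintegral_lt_top
  have hp : 0 ≤ 1 + ‖x‖ ^ 2 := by positivity
  rw [Real.enorm_of_nonneg (decayWeight_nonneg _ x), ← ENNReal.ofReal_pow (decayWeight_nonneg _ x),
    decayWeight, inv_pow, ← pow_mul, ← Real.rpow_natCast, ← Real.rpow_neg hp]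
  push_cast
  ring_nf

end Averaging

section Localization

open SchwartzMap Module
open scoped SchwartzMap ContDiff

variable {E : Type*} [NormedAddCommGroup E] [InnerProductSpace ℝ E] [MeasurableSpace E]
  [BorelSpace E] [FiniteDimensional ℝ E] {φ : E → ℝ} {U K : Set E}

lemma IsAmplitude.exists_maximalSq_mul_le {B : E → ℂ} (hB : IsAmplitude U B) :
    ∃ M : ℝ≥0, ∀ {T : Set ℝ} {μ : Measure E} {A : ℝ≥0∞}, MaximalBound φ T μ U A →
      ∀ {u : E → ℂ}, MemLp u 2 →
        maximalSq φ T (fun ζ => B ζ * u ζ) μ ≤ A * (M * eLpNorm u 2) ^ 2 := by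
  obtain ⟨M, hM⟩ := hB.contDiff.continuous.bounded_above_of_compact_support hB.hasCompactSupport
  have hM' : ∀ ζ, ‖B ζ‖₊ ≤ M.toNNReal := fun ζ => NNReal.le_toNNReal_of_coe_le (hM ζ)
  refine ⟨M.toNNReal, fun {T μ A} h {u} hu => ?_⟩
  have hle : ∀ᵐ ζ, ‖B ζ * u ζ‖₊ ≤ M.toNNReal * ‖u ζ‖₊ := .of_forall fun ζ => by
    rw [nnnorm_mul]
    exact mul_le_mul_left (hM' ζ) _
  have hmeas : AEStronglyMeasurable (fun ζ => B ζ * u ζ) volume :=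
    hB.contDiff.continuous.aestronglyMeasurable.mul hu.1
  have hint : Integrable fun ζ => B ζ * u ζ :=
    (hB.contDiff.continuous.memLp_of_hasCompactSupport hB.hasCompactSupport).integrable_mul
      (p := 2) (q := 2) hu
  refine (h _ hint (hu.of_nnnorm_le_mul hmeas hle) (.of_forall fun ζ hζ => ?_)).trans ?_
  · rw [image_eq_zero_of_notMem_tsupport fun h' => hζ (hB.tsupport_subset h'), zero_mul]
  · gcongr
    exact eLpNorm_le_nnreal_smul_eLpNorm_of_ae_le_mul hle 2

/-- Pairings with `h` inherit the maximal bounds of the propagator on each ball of observation. They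
are stated through a measurable majorant because the coefficients of a wave sum need not be
measurable in the position. -/
def HasMajorant (φ : E → ℝ) (U : Set E) (h : WaveParam E → 𝓢(E, ℂ)) : Prop :=
  ∃ C : ℝ≥0, ∀ {N : ℝ} {T : Set ℝ}, 1 ≤ N → (∀ t ∈ T, |t| ≤ N) →
    ∀ {y : E} {μ : Measure E} {A : ℝ≥0∞}, MaximalBound φ T (μ.restrict (ball y N)) U A →
    ∀ {u : E → ℂ}, MemLp u 2 → ∃ G : E → ℝ≥0∞, Measurable G ∧
      (∀ x ∈ ball y N, ∀ t ∈ T, ‖∫ ζ, h ⟨N, y, x, t⟩ ζ * u ζ‖ₑ ^ 2 ≤ G x) ∧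
      ∫⁻ x in ball y N, G x ∂μ ≤ C * (A * eLpNorm u 2 ^ 2)

lemma IsAmplitude.hasMajorant {B : E → ℂ} {c : WaveParam E → ℂ} {h : WaveParam E → 𝓢(E, ℂ)}
    (hφ : Measurable φ) (hB : IsAmplitude U B) (hc : IsBoundedCoeff c)
    (hh : ∀ p ζ, h p ζ = c p * (planeWave φ p.pos p.time ζ * B ζ)) : HasMajorant φ U h := by
  obtain ⟨L, hL⟩ := hc
  obtain ⟨M, hM⟩ := hB.exists_maximalSq_mul_le (φ := φ)
  refine ⟨L ^ 2 * M ^ 2, fun {N T} hN hT {y μ A} hA {u} hu => ?_⟩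
  have hint : Integrable fun ζ => B ζ * u ζ :=
    (hB.contDiff.continuous.memLp_of_hasCompactSupport hB.hasCompactSupport).integrable_mul
      (p := 2) (q := 2) hu
  have hm := measurable_biSup_enorm_extension_sq hφ hint T
  refine ⟨fun x => (L : ℝ≥0∞) ^ 2 * ⨆ t ∈ T, ‖extension φ (fun ζ => B ζ * u ζ) x t‖ₑ ^ 2,
    hm.const_mul _, fun x hx t ht => ?_, ?_⟩
  · have hwave : ∫ ζ, h ⟨N, y, x, t⟩ ζ * u ζ =
        c ⟨N, y, x, t⟩ * extension φ (fun ζ => B ζ * u ζ) x t := by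
      simp only [extension, ← integral_const_mul, hh, mul_assoc]
    rw [hwave, enorm_mul, mul_pow]
    refine mul_le_mul' (pow_le_pow_left' (ENNReal.coe_le_coe.2 (hL _ ?_)) 2)
      (le_biSup (fun t => ‖extension φ (fun ζ => B ζ * u ζ) x t‖ₑ ^ 2) ht)
    exact ⟨hN, (mem_ball_iff_norm.1 hx).le, hT t ht⟩
  · rw [lintegral_const_mul _ hm]
    refine (mul_le_mul_right (hM hA hu) _).trans_eq ?_
    push_cast
    ring

lemma HasMajorant.add {h₁ h₂ : WaveParam E → 𝓢(E, ℂ)} (hh₁ : HasMajorant φ U h₁)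
    (hh₂ : HasMajorant φ U h₂) : HasMajorant φ U fun p => h₁ p + h₂ p := by
  obtain ⟨C₁, hC₁⟩ := hh₁
  obtain ⟨C₂, hC₂⟩ := hh₂
  refine ⟨2 * (C₁ + C₂), fun {N T} hN hT {y μ A} hA {u} hu => ?_⟩
  obtain ⟨G₁, hm₁, hG₁, hI₁⟩ := hC₁ hN hT hA hu
  obtain ⟨G₂, hm₂, hG₂, hI₂⟩ := hC₂ hN hT hA hu
  have hint (h : 𝓢(E, ℂ)) : Integrable fun ζ => h ζ * u ζ :=
    (h.memLp 2).integrable_mul (p := 2) (q := 2) hu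
  refine ⟨fun x => 2 * (G₁ x + G₂ x), (hm₁.add hm₂).const_mul _, fun x hx t ht => ?_, ?_⟩
  · simp only [add_apply, add_mul]
    rw [integral_add (hint _) (hint _)]
    refine (enorm_add_sq_le _ _).trans ?_
    gcongr
    exacts [hG₁ x hx t ht, hG₂ x hx t ht]
  · rw [lintegral_const_mul _ (by fun_prop), lintegral_add_left hm₁]
    refine (mul_le_mul_right (add_le_add hI₁ hI₂) _).trans_eq ?_
    push_cast
    ring

lemma IsWaveSum.hasMajorant {h : WaveParam E → 𝓢(E, ℂ)} (hφ : Measurable φ)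
    (hh : IsWaveSum φ U h) : HasMajorant φ U h := by
  induction hh with
  | term hc hB hh => exact hB.hasMajorant hφ hc hh
  | add _ _ ih₁ ih₂ => exact ih₁.add ih₂

lemma exists_maximalSq_restrict_ball_le (hφ : Measurable φ) (hφU : ∀ ζ ∈ U, ContDiffAt ℝ ∞ φ ζ)
    (hK : IsCompact K) (hU : IsOpen U) (hKU : K ⊆ U) (m : ℕ) :
    ∃ C : ℝ≥0, ∀ {N : ℝ} {T : Set ℝ}, 1 ≤ N → (∀ t ∈ T, |t| ≤ N) →
      ∀ {y : E} {μ : Measure E} {A : ℝ≥0∞}, MaximalBound φ T (μ.restrict (ball y N)) U A →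
      ∀ f : Lp ℂ 2 (volume : Measure E),
        (∀ᵐ ζ, ζ ∉ K → (𝓕 f : Lp ℂ 2 (volume : Measure E)) ζ = 0) →
        maximalSq φ T (𝓕 f : Lp ℂ 2 (volume : Measure E)) (μ.restrict (ball y N)) ≤
          C * (A * eLpNorm (fun z => (decayWeight m (N⁻¹ • (z - y)) : ℂ) * f z) 2 ^ 2) := by
  obtain ⟨B, hB, hBK⟩ := IsAmplitude.exists_eq_one hK hU hKU
  have hwave : IsWaveSum φ U (amplitudeWave hφU hB) :=
    .term (c := fun _ => 1) ⟨1, fun _ _ => by simp⟩ hB fun p ζ => by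
      rw [one_mul, amplitudeWave_apply]
  obtain ⟨C, hC⟩ := (hwave.iterate_weightOperator hφU m).hasMajorant hφ
  refine ⟨C, fun {N T} hN hT {y μ A} hA f hf => ?_⟩
  have hF : MemLp (fun z => (decayWeight m (N⁻¹ • (z - y)) : ℂ) * f z) 2 := by
    have hw : Continuous fun z => (decayWeight m (N⁻¹ • (z - y)) : ℂ) :=
      Complex.continuous_ofReal.comp ((continuous_decayWeight m).comp (by fun_prop))
    refine (Lp.memLp f).of_le (hw.aestronglyMeasurable.mul (Lp.aestronglyMeasurable f))
      (.of_forall fun z => ?_)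
    rw [norm_mul, Complex.norm_real, Real.norm_of_nonneg (decayWeight_nonneg m _)]
    exact mul_le_of_le_one_left (norm_nonneg _) (decayWeight_le_one m _)
  have hFae := hF.coeFn_toLp
  set F := hF.toLp
  obtain ⟨G, -, hG, hGI⟩ := hC hN hT hA (Lp.memLp (𝓕 F))
  have hext : ∀ x t, extension φ (𝓕 f : Lp ℂ 2 (volume : Measure E)) x t =
      ∫ ζ, (weightOperator N y)^[m] (amplitudeWave hφU hB ⟨N, y, x, t⟩) ζ *
        (𝓕 F : Lp ℂ 2 (volume : Measure E)) ζ := fun x t => by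
    rw [← integral_schwartz_mul_fourier_eq_weightOperator N y m _ hFae]
    refine integral_congr_ae ?_
    filter_upwards [hf] with ζ hζ
    by_cases hζK : ζ ∈ K
    · rw [amplitudeWave_apply, hBK ζ hζK, mul_one]
    · rw [hζ hζK, mul_zero, mul_zero]
  rw [← eLpNorm_congr_ae hFae, ← eLpNorm_fourier]
  refine (setLIntegral_mono' measurableSet_ball fun x hx => iSup₂_le fun t ht => ?_).trans hGI
  rw [hext]
  exact hG x hx t ht

theorem exists_maximalBound_of_forall_ball (hφ : Measurable φ)
    (hφU : ∀ ζ ∈ U, ContDiffAt ℝ ∞ φ ζ) (hK : IsCompact K) (hU : IsOpen U) (hKU : K ⊆ U) :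
    ∃ C : ℝ≥0, ∀ {N : ℝ} {T : Set ℝ}, 1 ≤ N → (∀ t ∈ T, |t| ≤ N) →
      ∀ {μ : Measure E} [SFinite μ] {A : ℝ≥0∞}, A ≠ ⊤ →
        (∀ y, MaximalBound φ T (μ.restrict (ball y N)) U A) → MaximalBound φ T μ K (C * A) := by
  obtain ⟨C, hC⟩ := exists_maximalSq_restrict_ball_le hφ hφU hK hU hKU (finrank ℝ E + 1)
  lift ∫⁻ x : E, ‖decayWeight (finrank ℝ E + 1) x‖ₑ ^ 2 to ℝ≥0
    using lintegral_decayWeight_sq_lt_top.ne with I hI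
  have hV0 : volume (ball (0 : E) 1) ≠ 0 := (measure_ball_pos _ _ one_pos).ne'
  lift volume (ball (0 : E) 1) to ℝ≥0 using measure_ball_lt_top.ne with V hV
  refine ⟨V⁻¹ * (C * I), fun {N T} hN hT {μ _ A} hAtop hA g hg hg2 hgK => ?_⟩
  have hN0 : 0 < N := zero_lt_one.trans_le hN
  obtain ⟨f, hfg⟩ := exists_fourier_ae_eq hg2
  have hle := lintegral_mono (μ := volume) fun y => hC hN hT (hA y) f <| by
    filter_upwards [hfg, hgK] with ζ hζ hζK h
    rw [hζ, hζK h]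
  simp only [maximalSq, extension_congr hfg] at hle
  rw [lintegral_setLIntegral_ball hN0 (measurable_biSup_enorm_extension_sq hφ hg T),
    lintegral_const_mul' _ _ ENNReal.coe_ne_top, lintegral_const_mul' _ _ hAtop,
    lintegral_eLpNorm_decayWeight_mul_sq _ hN0, ← eLpNorm_fourier, eLpNorm_congr_ae hfg,
    ← hI, ← hV] at hle
  have hNn : ENNReal.ofReal (N ^ finrank ℝ E) ≠ 0 := (ENNReal.ofReal_pos.2 (by positivity)).ne'
  rw [ENNReal.coe_mul, ENNReal.coe_mul, ENNReal.coe_inv (ENNReal.coe_ne_zero.1 hV0), mul_assoc,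
    mul_assoc, ← ENNReal.mul_le_iff_le_inv hV0 ENNReal.coe_ne_top,
    ← ENNReal.mul_le_mul_iff_right hNn ENNReal.ofReal_ne_top]
  refine le_of_eq_of_le (mul_assoc _ _ _).symm (hle.trans_eq ?_)
  ring

end Localization

section BallConstants

variable {d : ℕ} {γ D : ℝ} {μ : Measure (EuclideanSpace ℝ (Fin d))}

lemma dimConst_le (hD : D ∈ ballConstants γ μ) : dimConst γ μ ≤ D :=
  csInf_le ⟨0, fun _ h => h.1⟩ hD

lemma dimConst_nonneg (γ : ℝ) (μ : Measure (EuclideanSpace ℝ (Fin d))) : 0 ≤ dimConst γ μ :=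
  Real.sInf_nonneg fun _ h => h.1

lemma dimConst_mem_ballConstants (hμ : IsDimensional γ μ) : dimConst γ μ ∈ ballConstants γ μ := by
  refine ⟨dimConst_nonneg γ μ, fun x ρ hρ => ?_⟩
  have hcont : Continuous fun D : ℝ => ENNReal.ofReal (D * ρ ^ γ) :=
    ENNReal.continuous_ofReal.comp (continuous_id.mul continuous_const)
  refine ge_of_tendsto (hcont.continuousWithinAt (s := Set.Ioi (dimConst γ μ))).tendsto ?_
  filter_upwards [self_mem_nhdsWithin] with D hD
  obtain ⟨D', hD', hlt⟩ := exists_lt_of_csInf_lt hμ hD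
  refine (hD'.2 x ρ hρ).trans ?_
  gcongr

lemma sigmaFinite_of_mem_ballConstants (hD : D ∈ ballConstants γ μ) : SigmaFinite μ := by
  have : IsLocallyFiniteMeasure μ :=
    ⟨fun x => ⟨ball x 1, ball_mem_nhds x one_pos,
      (hD.2 x 1 one_pos).trans_lt ENNReal.ofReal_lt_top⟩⟩
  infer_instance

lemma preimage_sub_const_ball_eq {E : Type*} [SeminormedAddCommGroup E] (x y : E) (ρ : ℝ) :
    (· - y) ⁻¹' ball x ρ = ball (x + y) ρ := by
  ext z
  simp only [Set.mem_preimage, mem_ball, dist_eq_norm, sub_sub, add_comm y x]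

lemma map_sub_const_mem_ballConstants (hD : D ∈ ballConstants γ μ) (y : EuclideanSpace ℝ (Fin d)) :
    D ∈ ballConstants γ (μ.map (· - y)) := by
  refine ⟨hD.1, fun x ρ hρ => ?_⟩
  rw [Measure.map_apply (measurable_sub_const y) measurableSet_ball, preimage_sub_const_ball_eq]
  exact hD.2 _ _ hρ

lemma preimage_const_smul_ball {E : Type*} [SeminormedAddCommGroup E] [NormedSpace ℝ E] {N : ℝ}
    (hN : 0 < N) (x : E) (ρ : ℝ) : (N • ·) ⁻¹' ball (N • x) (N * ρ) = ball x ρ := by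
  ext z
  simp only [Set.mem_preimage, mem_ball, dist_smul₀, Real.norm_of_nonneg hN.le,
    mul_lt_mul_iff_right₀ hN]

lemma map_smul_mem_ballConstants (hD : D ∈ ballConstants γ μ) {N : ℝ} (hN : 0 < N) :
    D * N ^ (-γ) ∈ ballConstants γ (μ.map (N • ·)) := by
  refine ⟨mul_nonneg hD.1 (by positivity), fun x ρ hρ => ?_⟩
  have hball := preimage_const_smul_ball hN (N⁻¹ • x) (N⁻¹ * ρ)
  rw [smul_inv_smul₀ hN.ne', mul_inv_cancel_left₀ hN.ne'] at hball
  rw [Measure.map_apply (measurable_const_smul N) measurableSet_ball, hball]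
  refine (hD.2 _ _ (by positivity)).trans_eq ?_
  rw [Real.mul_rpow (by positivity) hρ.le, Real.inv_rpow hN.le, Real.rpow_neg hN.le, mul_assoc]

end BallConstants

section Dilation

/-- The phase `|ζ|^α` of the propagator `e^{it(-Δ)^{α/2}}`. -/
def powerPhase {E : Type*} [NormedAddCommGroup E] (α : ℝ) (ζ : E) : ℝ := ‖ζ‖ ^ α

lemma measurable_powerPhase {E : Type*} [NormedAddCommGroup E] [MeasurableSpace E]
    [OpensMeasurableSpace E] (α : ℝ) : Measurable (powerPhase α : E → ℝ) :=
  measurable_norm.pow_const α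

lemma contDiffAt_powerPhase {E : Type*} [NormedAddCommGroup E] [InnerProductSpace ℝ E] (α : ℝ)
    {ζ : E} (hζ : ζ ≠ 0) {n : WithTop ℕ∞} : ContDiffAt ℝ n (powerPhase α) ζ :=
  (contDiffAt_norm ℝ hζ).rpow_const_of_ne (norm_ne_zero_iff.2 hζ)

variable {d : ℕ} {α γ : ℝ}

lemma smul_mem_annulus_iff {N : ℝ} (hN : 0 < N) (l : ℝ) (ζ : EuclideanSpace ℝ (Fin d)) :
    N • ζ ∈ annulus d (N * l) ↔ ζ ∈ annulus d l := by
  simp only [annulus, Set.mem_ofPred_eq, norm_smul, Real.norm_of_nonneg hN.le,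
    mul_left_comm 2 N l, mul_le_mul_iff_right₀ hN]

lemma fourierSupportedIn_iff {f : L2Space d} {l N : ℝ} (hN : 0 < N) :
    FourierSupportedIn f (2 * Real.pi * N * l) ↔
      ∀ᵐ η, η ∉ annulus d l → (𝓕 f : L2Space d) (N • η) = 0 := by
  have hc : 0 < 2 * Real.pi * N := by positivity
  have hNinv : (2 * Real.pi)⁻¹ * (2 * Real.pi * N) = N := by field_simp
  constructor
  · intro h
    filter_upwards [(Measure.quasiMeasurePreserving_smul volume hc.ne').ae h] with η hη hηl
    have := hη (mt (smul_mem_annulus_iff hc l η).1 hηl)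
    rwa [fourierHat, smul_smul, hNinv] at this
  · intro h
    filter_upwards [(Measure.quasiMeasurePreserving_smul volume (inv_ne_zero hc.ne')).ae h]
      with ξ hξ hξl
    rw [← smul_inv_smul₀ hc.ne' ξ, smul_mem_annulus_iff hc] at hξl
    have := hξ hξl
    rwa [← hNinv, ← smul_smul, hNinv, smul_inv_smul₀ hc.ne'] at this

lemma schrodinger_eq_extension (f : L2Space d) (x : EuclideanSpace ℝ (Fin d)) (t : ℝ) {N : ℝ}
    (hN : 0 < N) :
    schrodinger α t f x = ((N ^ d : ℝ) : ℂ) * extension (powerPhase α)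
      (fun η => (𝓕 f : L2Space d) (N • η)) (N • x) ((2 * Real.pi * N) ^ α * t) := by
  have hc : 0 < 2 * Real.pi * N := by positivity
  have hwave : ∀ η : EuclideanSpace ℝ (Fin d),
      planeWave (powerPhase α) (N • x) ((2 * Real.pi * N) ^ α * t) η =
        Complex.exp (Complex.I * ((inner ℝ x ((2 * Real.pi * N) • η) +
          t * ‖(2 * Real.pi * N) • η‖ ^ α : ℝ) : ℂ)) := fun η => by
    simp only [planeWave, powerPhase, inner_smul_left, inner_smul_right, norm_smul,
      Real.norm_of_nonneg hc.le, Real.mul_rpow hc.le (norm_nonneg _), conj_trivial,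
      mul_comm Complex.I]
    ring_nf
  have hhat : ∀ η : EuclideanSpace ℝ (Fin d),
      (𝓕 f : L2Space d) (N • η) = fourierHat f ((2 * Real.pi * N) • η) := fun η => by
    rw [fourierHat, smul_smul, inv_mul_cancel_left₀ (by positivity)]
  simp only [extension, hwave, hhat]
  rw [Measure.integral_comp_smul volume (fun ξ : EuclideanSpace ℝ (Fin d) =>
      Complex.exp (Complex.I * ((inner ℝ x ξ + t * ‖ξ‖ ^ α : ℝ) : ℂ)) * fourierHat f ξ),
    schrodinger, finrank_euclideanSpace_fin, Complex.real_smul, ← mul_assoc, ← Complex.ofReal_mul,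
    abs_of_pos (by positivity)]
  congr 2
  field_simp
  ring

lemma maximalNorm_sq_eq {ι : Type} (τ : ι → ℝ) (f : L2Space d)
    (μ : Measure (EuclideanSpace ℝ (Fin d))) {N : ℝ} (hN : 0 < N) :
    maximalNorm α τ f μ ^ 2 = ENNReal.ofReal (N ^ d) ^ 2 *
      maximalSq (powerPhase α) (Set.range fun i => (2 * Real.pi * N) ^ α * τ i)
        (fun η => (𝓕 f : L2Space d) (N • η)) ((μ.map (N • ·)).restrict (ball 0 N)) := by
  have hball := preimage_const_smul_ball hN (0 : EuclideanSpace ℝ (Fin d)) 1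
  rw [smul_zero, mul_one] at hball
  have hemb := (MeasurableEquiv.smul₀ (α := EuclideanSpace ℝ (Fin d)) N hN.ne').measurableEmbedding
  have hNd : ‖((N ^ d : ℝ) : ℂ)‖ₑ = ENNReal.ofReal (N ^ d) := by
    rw [← ofReal_norm, Complex.norm_real, Real.norm_of_nonneg (by positivity)]
  rw [maximalNorm, eLpNorm_two_sq, maximalSq,
    Measure.restrict_map (measurable_const_smul N) measurableSet_ball, hball,
    ← lintegral_const_mul' _ _ (by finiteness)]
  refine Eq.trans (lintegral_congr fun x => ?_) (hemb.lintegral_map _).symm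
  simp only [enorm_eq_self, iSup_range, ENNReal.iSup_pow_of_ne_zero two_ne_zero, ENNReal.mul_iSup,
    schrodinger_eq_extension f x _ hN, enorm_mul, mul_pow, hNd, MeasurableEquiv.coe_smul₀]

lemma ofReal_norm_sq_eq (f : L2Space d) {N : ℝ} (hN : 0 < N) :
    ENNReal.ofReal (‖f‖ ^ 2) = ENNReal.ofReal (N ^ d) *
      eLpNorm (fun η => (𝓕 f : L2Space d) (N • η)) 2 volume ^ 2 := by
  have h := lintegral_comp_inv_smul hN fun η => ‖(𝓕 f : L2Space d) (N • η)‖ₑ ^ 2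
  simp only [smul_inv_smul₀ hN.ne', finrank_euclideanSpace_fin] at h
  rw [eLpNorm_two_sq, ← h, ← eLpNorm_two_sq, eLpNorm_fourier, ← Lp.enorm_def, ← ofReal_norm,
    ENNReal.ofReal_pow (norm_nonneg f)]

lemma rescaled_constant_sq {σ c N C D : ℝ} (hc : 0 < c) (hN : 0 < N) (hD : 0 ≤ D) :
    (C * (c * N) ^ (((d : ℝ) - γ) / 2 + σ) * D ^ ((1 : ℝ) / 2)) ^ 2 =
      N ^ d * (C ^ 2 * c ^ ((d : ℝ) - γ) * ((c * N) ^ (2 * σ) * (D * N ^ (-γ)))) := by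
  have hpow : ((c * N) ^ (((d : ℝ) - γ) / 2 + σ)) ^ 2 =
      c ^ ((d : ℝ) - γ) * (N ^ d * N ^ (-γ)) * (c * N) ^ (2 * σ) := by
    rw [← Real.rpow_natCast N d, ← Real.rpow_add hN, ← sub_eq_add_neg,
      ← Real.mul_rpow hc.le hN.le, ← Real.rpow_add (by positivity), ← Real.rpow_mul_natCast
      (by positivity)]
    congr 1
    push_cast
    ring
  rw [mul_pow, mul_pow, hpow, ← Real.sqrt_eq_rpow, Real.sq_sqrt hD]
  ring

lemma maximalNorm_le_iff {ι : Type} {τ : ι → ℝ} {f : L2Space d}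
    {μ : Measure (EuclideanSpace ℝ (Fin d))} {σ c N C D : ℝ} (hc : 0 < c) (hN : 0 < N)
    (hC : 0 ≤ C) (hD : 0 ≤ D) :
    maximalNorm α τ f μ ≤ ENNReal.ofReal
        (C * (c * N) ^ (((d : ℝ) - γ) / 2 + σ) * D ^ ((1 : ℝ) / 2) * ‖f‖) ↔
      maximalSq (powerPhase α) (Set.range fun i => (2 * Real.pi * N) ^ α * τ i)
        (fun η => (𝓕 f : L2Space d) (N • η)) ((μ.map (N • ·)).restrict (ball 0 N)) ≤
      ENNReal.ofReal (C ^ 2 * c ^ ((d : ℝ) - γ) * ((c * N) ^ (2 * σ) * (D * N ^ (-γ)))) *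
        eLpNorm (fun η => (𝓕 f : L2Space d) (N • η)) 2 volume ^ 2 := by
  have hNd : ENNReal.ofReal (N ^ d) ≠ 0 := (ENNReal.ofReal_pos.2 (by positivity)).ne'
  have hsq : ENNReal.ofReal
        (C * (c * N) ^ (((d : ℝ) - γ) / 2 + σ) * D ^ ((1 : ℝ) / 2) * ‖f‖) ^ 2 =
      ENNReal.ofReal (N ^ d) ^ 2 *
        (ENNReal.ofReal (C ^ 2 * c ^ ((d : ℝ) - γ) * ((c * N) ^ (2 * σ) * (D * N ^ (-γ)))) *
          eLpNorm (fun η => (𝓕 f : L2Space d) (N • η)) 2 volume ^ 2) := by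
    rw [← ENNReal.ofReal_pow (by positivity), mul_pow, rescaled_constant_sq hc hN hD,
      ENNReal.ofReal_mul (by positivity), ofReal_norm_sq_eq f hN,
      ENNReal.ofReal_mul (by positivity)]
    ring
  rw [← ENNReal.pow_le_pow_left_iff two_ne_zero, maximalNorm_sq_eq τ f μ hN, hsq,
    ENNReal.mul_le_mul_iff_right (pow_ne_zero 2 hNd) (by finiteness)]

end Dilation

section UnitScale

variable {d : ℕ} {α γ σ : ℝ}

/-- The maximal estimate over the times `τ` with the loss `R^{(d-γ)/2+σ}`, for frequencies of size
`R` and `γ`-dimensional measures on the unit ball. -/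
def HasMaximalExponent {ι : Type} (d : ℕ) (α γ : ℝ) (τ : ι → ℝ) (σ : ℝ) : Prop :=
  ∃ C : ℝ, 0 < C ∧ ∀ R : ℝ, 1 ≤ R →
    ∀ μ : Measure (EuclideanSpace ℝ (Fin d)), IsDimensional γ μ →
    ∀ f : L2Space d, FourierSupportedIn f R →
      maximalNorm α τ f μ ≤ ENNReal.ofReal
        (C * R ^ (((d : ℝ) - γ) / 2 + σ) * dimConst γ μ ^ ((1 : ℝ) / 2) * ‖f‖)

/-- The form that `HasMaximalExponent` takes when frequencies of size `N` are dilated to unit size: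
frequencies in the fixed set `S`, position in the window `W N` and times in `T N`. The dilation
absorbs the factor `N^{(d-γ)/2}`, so that the loss in the squared estimate is `N^{2σ}`. -/
def HasUnitScaleExponent (α γ σ : ℝ) (W : ℝ → Set (EuclideanSpace ℝ (Fin d))) (T : ℝ → Set ℝ)
    (S : Set (EuclideanSpace ℝ (Fin d))) : Prop :=
  ∃ C : ℝ≥0, ∀ N : ℝ, 1 ≤ N → ∀ (μ : Measure (EuclideanSpace ℝ (Fin d))),
    ∀ D ∈ ballConstants γ μ,
      MaximalBound (powerPhase α) (T N) (μ.restrict (W N)) S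
        (C * ENNReal.ofReal (N ^ (2 * σ) * D))

lemma isCompact_annulus (d : ℕ) (l : ℝ) : IsCompact (annulus d l) :=
  (isCompact_closedBall 0 (2 * l)).of_isClosed_subset
    ((isClosed_le continuous_const continuous_norm).inter
      (isClosed_le continuous_norm continuous_const))
    fun _ hζ => mem_closedBall_zero_iff.2 hζ.2

lemma map_smul_map_inv_smul {N : ℝ} (hN : N ≠ 0) (μ : Measure (EuclideanSpace ℝ (Fin d))) :
    (μ.map (N⁻¹ • ·)).map (N • ·) = μ := by
  rw [Measure.map_map (measurable_const_smul N) (measurable_const_smul N⁻¹)]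
  simp only [Function.comp_def, smul_inv_smul₀ hN, Measure.map_id']

lemma memLp_comp_smul {g : EuclideanSpace ℝ (Fin d) → ℂ} {p : ℝ≥0∞} (hg : MemLp g p) {N : ℝ}
    (hN : N ≠ 0) : MemLp (fun η => g (N • η)) p := by
  refine MemLp.comp_of_map ?_ (measurable_const_smul N).aemeasurable
  rw [Measure.map_addHaar_smul _ hN]
  exact hg.smul_measure ENNReal.ofReal_ne_top

lemma exists_fourier_smul_ae_eq {g : EuclideanSpace ℝ (Fin d) → ℂ} (hg : MemLp g 2) {N : ℝ}
    (hN : N ≠ 0) :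
    ∃ f : L2Space d, (fun η => (𝓕 f : L2Space d) (N • η)) =ᵐ[volume] g := by
  obtain ⟨f, hf⟩ := exists_fourier_ae_eq (memLp_comp_smul hg (inv_ne_zero hN))
  refine ⟨f, ?_⟩
  filter_upwards [(Measure.quasiMeasurePreserving_smul volume hN).ae hf] with η hη
  rw [hη, inv_smul_smul₀ hN]

theorem HasMaximalExponent.hasUnitScaleExponent {ι : Type} {τ : ι → ℝ}
    (h : HasMaximalExponent d α γ τ σ) {l : ℝ} (hl : 1 ≤ 2 * Real.pi * l) :
    HasUnitScaleExponent α γ σ (ball 0)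
      (fun N => Set.range fun i => (2 * Real.pi * N) ^ α * τ i) (annulus d l) := by
  obtain ⟨C, hC0, hC⟩ := h
  set c := 2 * Real.pi * l with hc_def
  have hc : 0 < c := zero_lt_one.trans_le hl
  refine ⟨(C ^ 2 * c ^ ((d : ℝ) - γ) * c ^ (2 * σ)).toNNReal,
    fun N hN μ D hD g _ hg hgl => ?_⟩
  have hN0 : 0 < N := zero_lt_one.trans_le hN
  have hD' := map_smul_mem_ballConstants hD (inv_pos.2 hN0)
  obtain ⟨f, hf⟩ := exists_fourier_smul_ae_eq hg hN0.ne'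
  have hsupp : FourierSupportedIn f (c * N) := by
    rw [hc_def, mul_right_comm, fourierSupportedIn_iff hN0]
    filter_upwards [hf, hgl] with η hη hηl h
    rw [hη, hηl h]
  have hbound : maximalNorm α τ f (μ.map (N⁻¹ • ·)) ≤ ENNReal.ofReal (C *
      (c * N) ^ (((d : ℝ) - γ) / 2 + σ) * (D * N⁻¹ ^ (-γ)) ^ ((1 : ℝ) / 2) * ‖f‖) := by
    refine (hC _ (one_le_mul_of_one_le_of_one_le hl hN) _ ⟨_, hD'⟩ f hsupp).trans ?_
    have := dimConst_nonneg γ (μ.map (N⁻¹ • ·))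
    gcongr
    exact dimConst_le hD'
  rw [maximalNorm_le_iff hc hN0 hC0.le hD'.1, map_smul_map_inv_smul hN0.ne', maximalSq,
    extension_congr hf, ← maximalSq, eLpNorm_congr_ae hf] at hbound
  refine hbound.trans_eq ?_
  congr 1
  rw [← ENNReal.ofReal, ← ENNReal.ofReal_mul (by positivity), Real.mul_rpow hc.le hN0.le,
    Real.inv_rpow hN0.le, Real.rpow_neg hN0.le, inv_inv, mul_assoc D,
    mul_inv_cancel₀ (by positivity)]
  ring_nf

theorem HasUnitScaleExponent.hasMaximalExponent {ι : Type} {τ : ι → ℝ}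
    (h : HasUnitScaleExponent α γ σ (ball 0) (fun N => Set.range fun i => N ^ α * τ i)
      (annulus d 1)) : HasMaximalExponent d α γ τ σ := by
  obtain ⟨C, hC⟩ := h
  have hc : 0 < 2 * Real.pi := by positivity
  refine ⟨√((C + 1) * (2 * Real.pi) ^ (γ - d)), by positivity, fun R hR μ hμ f hf => ?_⟩
  obtain ⟨N, rfl⟩ : ∃ N, 2 * Real.pi * N = R := ⟨R / (2 * Real.pi), by field_simp⟩
  have hN : 0 < N := pos_of_mul_pos_right (zero_lt_one.trans_le hR) hc.le
  have hNR : N ≤ 2 * Real.pi * N := by nlinarith [Real.pi_gt_three]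
  have hD := dimConst_mem_ballConstants hμ
  rw [maximalNorm_le_iff hc hN (by positivity) hD.1]
  have hg2 : MemLp (fun η => (𝓕 f : L2Space d) (N • η)) 2 := memLp_comp_smul (Lp.memLp _) hN.ne'
  rw [← mul_one (2 * Real.pi * N), fourierSupportedIn_iff hN] at hf
  have hg : Integrable (fun η => (𝓕 f : L2Space d) (N • η)) :=
    IntegrableOn.integrable_of_ae_notMem_eq_zero
      ((hg2.locallyIntegrable one_le_two).integrableOn_isCompact (isCompact_annulus d 1)) hf
  refine (((hC _ hR _ _ (map_smul_mem_ballConstants hD hN)).mono le_rfl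
    (Measure.restrict_mono (ball_subset_ball hNR) le_rfl) le_rfl le_rfl) _ hg hg2 hf).trans ?_
  refine mul_le_mul_left ?_ _
  have hconst : √((C + 1) * (2 * Real.pi) ^ (γ - d)) ^ 2 * (2 * Real.pi) ^ ((d : ℝ) - γ) =
      C + 1 := by
    rw [Real.sq_sqrt (by positivity), mul_assoc, ← Real.rpow_add hc, sub_add_sub_cancel, sub_self,
      Real.rpow_zero, mul_one]
  rw [hconst, ENNReal.ofReal_mul (by positivity : (0 : ℝ) ≤ C + 1)]
  refine mul_le_mul_left ?_ _
  rw [← ENNReal.ofReal_coe_nnreal]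
  exact ENNReal.ofReal_le_ofReal (le_add_of_nonneg_right zero_le_one)

end UnitScale

namespace HasUnitScaleExponent

variable {d : ℕ} {α γ σ σ' : ℝ} {W W' : ℝ → Set (EuclideanSpace ℝ (Fin d))} {T T' : ℝ → Set ℝ}
  {S S' : Set (EuclideanSpace ℝ (Fin d))}

lemma mono (h : HasUnitScaleExponent α γ σ W' T' S') (hW : ∀ N, W N ⊆ W' N)
    (hT : ∀ N, 1 ≤ N → T N ⊆ T' N) (hS : S ⊆ S') : HasUnitScaleExponent α γ σ W T S := by
  obtain ⟨C, hC⟩ := h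
  exact ⟨C, fun N hN μ D hD =>
    (hC N hN μ D hD).mono (hT N hN) (Measure.restrict_mono (hW N) le_rfl) hS le_rfl⟩

lemma union_times (h : HasUnitScaleExponent α γ σ W T S) (h' : HasUnitScaleExponent α γ σ W T' S) :
    HasUnitScaleExponent α γ σ W (fun N => T N ∪ T' N) S := by
  obtain ⟨C, hC⟩ := h
  obtain ⟨C', hC'⟩ := h'
  refine ⟨C + C', fun N hN μ D hD => ?_⟩
  rw [ENNReal.coe_add, add_mul]
  exact (hC N hN μ D hD).union_times (measurable_powerPhase α) (hC' N hN μ D hD)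

lemma union_support (h : HasUnitScaleExponent α γ σ W T S)
    (h' : HasUnitScaleExponent α γ σ W T S') (hS : MeasurableSet S) :
    HasUnitScaleExponent α γ σ W T (S ∪ S') := by
  obtain ⟨C, hC⟩ := h
  obtain ⟨C', hC'⟩ := h'
  refine ⟨2 * (C + C'), fun N hN μ D hD => ?_⟩
  rw [ENNReal.coe_mul, ENNReal.coe_add, mul_assoc, add_mul]
  exact (hC N hN μ D hD).union_support (measurable_powerPhase α) hS (hC' N hN μ D hD)

lemma of_translates (h : HasUnitScaleExponent α γ σ W T S) {K : ℝ≥0} {F : ℝ → Finset ℝ}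
    (hF : ∀ N, 1 ≤ N → ((F N).card : ℝ) ≤ K * N ^ (2 * σ'))
    (hT : ∀ N, 1 ≤ N → T' N ⊆ ⋃ s ∈ F N, (· + s) '' T N) :
    HasUnitScaleExponent α γ (σ' + σ) W T' S := by
  obtain ⟨C, hC⟩ := h
  refine ⟨K * C, fun N hN μ D hD => ?_⟩
  have hN0 : 0 < N := zero_lt_one.trans_le hN
  have hcard : ((F N).card : ℝ≥0∞) ≤ K * ENNReal.ofReal (N ^ (2 * σ')) := by
    rw [← ENNReal.ofReal_natCast, ← ENNReal.ofReal_coe_nnreal, ← ENNReal.ofReal_mul K.coe_nonneg]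
    exact ENNReal.ofReal_le_ofReal (hF N hN)
  refine (MaximalBound.biUnion_times (measurable_powerPhase α) fun s _ =>
    (hC N hN μ D hD).image_add_const (measurable_powerPhase α) s).mono (hT N hN) le_rfl le_rfl ?_
  rw [Finset.sum_const, nsmul_eq_mul, mul_add, Real.rpow_add hN0, mul_assoc (N ^ (2 * σ')),
    ENNReal.ofReal_mul (by positivity : 0 ≤ N ^ (2 * σ')), ENNReal.coe_mul, mul_mul_mul_comm]
  exact by gcongr

lemma comp_rpow (h : HasUnitScaleExponent α γ σ (fun _ => Set.univ) T S) {κ : ℝ} (hκ : 0 ≤ κ) :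
    HasUnitScaleExponent α γ (κ * σ) (fun _ => Set.univ) (fun N => T (N ^ κ)) S := by
  obtain ⟨C, hC⟩ := h
  refine ⟨C, fun N hN μ D hD => ?_⟩
  rw [mul_left_comm, Real.rpow_mul (zero_le_one.trans hN)]
  exact hC _ (Real.one_le_rpow hN hκ) μ D hD

lemma univ_of_ball {U K : Set (EuclideanSpace ℝ (Fin d))}
    (h : HasUnitScaleExponent α γ σ (ball 0) T U) (hT : ∀ N, 1 ≤ N → ∀ t ∈ T N, |t| ≤ N)
    (hU : IsOpen U) (hU0 : 0 ∉ U) (hK : IsCompact K) (hKU : K ⊆ U) :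
    HasUnitScaleExponent α γ σ (fun _ => Set.univ) T K := by
  obtain ⟨C, hC⟩ := h
  obtain ⟨C', hC'⟩ := exists_maximalBound_of_forall_ball (measurable_powerPhase α)
    (fun ζ hζ => contDiffAt_powerPhase α (ne_of_mem_of_not_mem hζ hU0)) hK hU hKU
  refine ⟨C' * C, fun N hN μ D hD => ?_⟩
  have := sigmaFinite_of_mem_ballConstants hD
  rw [Measure.restrict_univ, ENNReal.coe_mul, mul_assoc]
  refine hC' hN (hT N hN) (by finiteness) fun y => .of_map_sub_const (measurable_powerPhase α)
    (y := y) ?_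
  have hball := preimage_sub_const_ball_eq 0 y N
  rw [zero_add] at hball
  rw [← hball, ← Measure.restrict_map (measurable_sub_const y) measurableSet_ball]
  exact hC N hN _ D (map_sub_const_mem_ballConstants hD y)

end HasUnitScaleExponent

section Times

variable {d : ℕ} {α γ σ : ℝ}

lemma setOf_abs_le_subset_iUnion_image_Ioc {a : ℝ} (ha : 0 < a) (k : ℕ) :
    {t : ℝ | |t| ≤ k * a} ⊆
      ⋃ m ∈ Finset.Ico (-(k + 1) : ℤ) k, (· + m * a) '' Set.Ioc 0 a := by
  intro t ht
  obtain ⟨m, ⟨hm, hm'⟩, -⟩ := existsUnique_sub_zsmul_mem_Ioc ha t 0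
  rw [zero_add] at hm'
  rw [zsmul_eq_mul] at hm hm'
  obtain ⟨htl, htr⟩ := abs_le.1 (show |t| ≤ k * a from ht)
  have hlow : (-(k + 1) : ℝ) ≤ m := le_of_mul_le_mul_right (by linarith) ha
  have hupp : (m : ℝ) < k := lt_of_mul_lt_mul_right (by linarith) ha.le
  refine Set.mem_biUnion (x := m) ?_ ⟨t - m * a, ⟨hm, hm'⟩, sub_add_cancel _ _⟩
  exact Finset.mem_coe.2 (Finset.mem_Ico.2 ⟨by exact_mod_cast hlow, by exact_mod_cast hupp⟩)

/-- The times `|t| ≤ N` during which unit frequencies stay in a ball of radius `N`, as far as they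
come from times `|t| ≤ 1` before the dilation by `N`. -/
def shortTimes (α N : ℝ) : Set ℝ := {t | |t| ≤ N ∧ |t| ≤ N ^ α}

lemma HasUnitScaleExponent.abs_le_of_Ioc {W : ℝ → Set (EuclideanSpace ℝ (Fin d))}
    {S : Set (EuclideanSpace ℝ (Fin d))}
    (h : HasUnitScaleExponent α γ σ W (fun N => Set.Ioc 0 (N ^ α)) S) (k : ℕ) :
    HasUnitScaleExponent α γ σ W (fun N => {t | |t| ≤ k * N ^ α}) S := by
  classical
  rw [← zero_add σ]
  refine h.of_translates (K := (Finset.Ico (-(k + 1) : ℤ) k).card)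
    (F := fun N => (Finset.Ico (-(k + 1) : ℤ) k).image fun m : ℤ => (m : ℝ) * N ^ α)
    (fun N _ => ?_) fun N hN => ?_
  · rw [mul_zero, Real.rpow_zero, mul_one, NNReal.coe_natCast]
    exact_mod_cast Finset.card_image_le
  · rw [Finset.set_biUnion_finset_image]
    exact setOf_abs_le_subset_iUnion_image_Ioc (by positivity : 0 < N ^ α) k

lemma HasMaximalExponent.hasUnitScaleExponent_Ioc (hα : 0 ≤ α)
    (h : HasMaximalExponent d α γ (fun t : Set.Ioc (0 : ℝ) 1 => (t : ℝ)) σ) {l : ℝ}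
    (hl : 1 ≤ 2 * Real.pi * l) :
    HasUnitScaleExponent α γ σ (ball 0) (fun N => Set.Ioc 0 (N ^ α)) (annulus d l) := by
  refine (h.hasUnitScaleExponent hl).mono (fun _ => le_rfl) (fun N hN t ht => ?_) le_rfl
  have hpos : 0 < (2 * Real.pi * N) ^ α := by positivity
  have hle : N ^ α ≤ (2 * Real.pi * N) ^ α := by
    gcongr
    nlinarith [Real.pi_gt_three]
  exact ⟨⟨t / (2 * Real.pi * N) ^ α, div_pos ht.1 hpos, (div_le_one hpos).2 (ht.2.trans hle)⟩,
    mul_div_cancel₀ _ hpos.ne'⟩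

lemma HasMaximalExponent.hasUnitScaleExponent_shortTimes (hα : 0 ≤ α)
    (h : HasMaximalExponent d α γ (fun t : Set.Ioc (0 : ℝ) 1 => (t : ℝ)) σ) :
    HasUnitScaleExponent α γ σ (fun _ => Set.univ) (shortTimes α) (annulus d 1) := by
  have hann : ∀ l : ℝ, 1 / 2 ≤ l → HasUnitScaleExponent α γ σ (ball 0)
      (fun N => {t | |t| ≤ (1 : ℕ) * N ^ α}) (annulus d l) := fun l hl =>
    (h.hasUnitScaleExponent_Ioc hα (by nlinarith [Real.pi_gt_three])).abs_le_of_Ioc 1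
  set U : Set (EuclideanSpace ℝ (Fin d)) := {ζ | 1 / 2 < ‖ζ‖ ∧ ‖ζ‖ < 4} with hU_def
  have hcover : U ⊆ annulus d (1 / 2) ∪ (annulus d 1 ∪ annulus d 2) := fun ζ ⟨hl, hr⟩ => by
    simp only [annulus, Set.mem_union, Set.mem_ofPred_eq]
    grind
  have hUopen : IsOpen U := (isOpen_lt continuous_const continuous_norm).inter
    (isOpen_lt continuous_norm continuous_const)
  have hKU : annulus d 1 ⊆ U := fun ζ ⟨hl, hr⟩ => ⟨by linarith, by linarith⟩
  refine HasUnitScaleExponent.univ_of_ball (U := U) ?_ (fun N _ t ht => ht.1) hUopen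
    (by simp [hU_def]) (isCompact_annulus d 1) hKU
  refine HasUnitScaleExponent.mono ((hann (1 / 2) le_rfl).union_support
    ((hann 1 (by norm_num)).union_support (hann 2 (by norm_num)) ?_) ?_)
    (fun _ => le_rfl) (fun N _ t ht => ?_) hcover
  · exact (isCompact_annulus d 1).measurableSet
  · exact (isCompact_annulus d _).measurableSet
  · simpa using ht.2

end Times

section WeakEll

lemma MemWeakEll.exists_card_bound {r : ℝ} {t : ℕ → ℝ} (ht : MemWeakEll r t) :
    ∃ K : ℝ≥0, ∀ δ : ℝ, 0 < δ → ∃ A : Finset ℕ, (∀ n, δ ≤ |t n| → n ∈ A) ∧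
      (A.card : ℝ) * δ ^ r ≤ K := by
  lift (⨆ (δ : ℝ) (_ : 0 < δ), ENNReal.ofReal (δ ^ r) *
    (({n : ℕ | δ ≤ |t n|}.encard : ℕ∞) : ℝ≥0∞)) to ℝ≥0 using ne_of_lt ht with K hK
  refine ⟨K, fun δ hδ => ?_⟩
  have hle : ENNReal.ofReal (δ ^ r) * (({n : ℕ | δ ≤ |t n|}.encard : ℕ∞) : ℝ≥0∞) ≤ K := by
    rw [hK]
    exact le_iSup₂ (f := fun (δ : ℝ) (_ : 0 < δ) =>
      ENNReal.ofReal (δ ^ r) * (({n : ℕ | δ ≤ |t n|}.encard : ℕ∞) : ℝ≥0∞)) δ hδ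
  have hpos : 0 < δ ^ r := Real.rpow_pos_of_pos hδ r
  have hfin : {n : ℕ | δ ≤ |t n|}.Finite := by
    by_contra hinf
    rw [Set.Infinite.encard_eq hinf, ENat.toENNReal_top,
      ENNReal.mul_top (ENNReal.ofReal_pos.2 hpos).ne'] at hle
    exact ENNReal.coe_ne_top (top_le_iff.1 hle)
  refine ⟨hfin.toFinset, fun n hn => hfin.mem_toFinset.2 hn, ?_⟩
  rw [hfin.encard_eq_coe_toFinset_card] at hle
  have hreal := ENNReal.toReal_mono ENNReal.coe_ne_top hle
  rw [ENNReal.toReal_mul, ENNReal.toReal_ofReal hpos.le] at hreal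
  rwa [mul_comm] at hreal

lemma MemWeakEll.exists_abs_le {r : ℝ} {t : ℕ → ℝ} (ht : MemWeakEll r t) :
    ∃ k : ℕ, ∀ n, |t n| ≤ k := by
  obtain ⟨K, hK⟩ := ht.exists_card_bound
  obtain ⟨A, hA, -⟩ := hK 1 one_pos
  obtain ⟨k, hk⟩ := exists_nat_ge (∑ n ∈ A, |t n| + 1)
  have hsum : 0 ≤ ∑ n ∈ A, |t n| := Finset.sum_nonneg fun n _ => abs_nonneg (t n)
  refine ⟨k, fun n => le_trans ?_ hk⟩
  by_cases hn : n ∈ A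
  · linarith [Finset.single_le_sum (fun n _ => abs_nonneg (t n)) hn]
  · linarith [lt_of_not_ge (mt (hA n) hn)]

/-- The exponent `κ` for which, with `δ = N^{-2κs/r}`, the rescaled times `N^α t` with `|t| < δ` are
short times at scale `N^κ`, while a sequence in `ℓ^{r,∞}` has `O(N^{2κs})` terms with `|t| ≥ δ`. -/
def balancedExponent (α r s : ℝ) : ℝ := r * α / (r * min α 1 + 2 * s)

lemma MemWeakEll.exists_range_subset {α r s : ℝ} (hα : 0 < α) (hr : 0 < r) (hs : 0 ≤ s)
    {t : ℕ → ℝ} (ht : MemWeakEll r t) :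
    ∃ (K : ℝ≥0) (F : ℝ → Finset ℝ), ∀ N : ℝ, 1 ≤ N →
      ((F N).card : ℝ) ≤ K * N ^ (2 * (balancedExponent α r s * s)) ∧
      (Set.range fun n => N ^ α * t n) ⊆ shortTimes α (N ^ balancedExponent α r s) ∪ F N := by
  classical
  obtain ⟨K, hK⟩ := ht.exists_card_bound
  choose! A hA hcard using hK
  set κ := balancedExponent α r s with hκ
  have hκ0 : 0 ≤ κ := by rw [hκ, balancedExponent]; positivity
  have hbalance : α + -(2 * (κ * s) / r) = κ * min α 1 := by
    rw [hκ, balancedExponent]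
    field_simp
    ring
  refine ⟨K, fun N => (A (N ^ (-(2 * (κ * s) / r)))).image fun n => N ^ α * t n,
    fun N hN => ⟨?_, ?_⟩⟩
  all_goals
    have hN0 : 0 < N := zero_lt_one.trans_le hN
    have hδ : 0 < N ^ (-(2 * (κ * s) / r)) := by positivity
  · refine (Nat.cast_le.2 Finset.card_image_le).trans ?_
    have := hcard _ hδ
    rwa [← Real.rpow_mul hN0.le, neg_mul, div_mul_cancel₀ _ hr.ne',
      Real.rpow_neg hN0.le (2 * (κ * s)), ← div_eq_mul_inv, div_le_iff₀ (by positivity)] at this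
  · rintro _ ⟨n, rfl⟩
    by_cases hn : n ∈ A (N ^ (-(2 * (κ * s) / r)))
    · exact .inr (Finset.mem_coe.2 (Finset.mem_image_of_mem _ hn))
    have habs : |N ^ α * t n| ≤ N ^ (κ * min α 1) := by
      rw [abs_mul, abs_of_pos (by positivity : 0 < N ^ α), ← hbalance, Real.rpow_add hN0]
      gcongr
      exact (lt_of_not_ge (mt (hA _ hδ n) hn)).le
    refine .inl ⟨habs.trans ?_, habs.trans ?_⟩
    · exact Real.rpow_le_rpow_of_exponent_le hN (mul_le_of_le_one_right hκ0 (min_le_right _ _))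
    · rw [← Real.rpow_mul hN0.le]
      exact Real.rpow_le_rpow_of_exponent_le hN (mul_le_mul_of_nonneg_left (min_le_left _ _) hκ0)

end WeakEll

section Sequence

variable {d : ℕ} {α γ σ : ℝ}

theorem HasMaximalExponent.of_forall_abs_le {ι : Type} (hα : 0 ≤ α)
    (h : HasMaximalExponent d α γ (fun t : Set.Ioc (0 : ℝ) 1 => (t : ℝ)) σ) {t : ι → ℝ} {k : ℕ}
    (hk : ∀ i, |t i| ≤ k) : HasMaximalExponent d α γ t σ := by
  have hunit := (h.hasUnitScaleExponent_Ioc (l := 1) hα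
    (by linarith [Real.pi_gt_three])).abs_le_of_Ioc k
  refine (hunit.mono (fun _ => le_rfl) (fun N hN => ?_) le_rfl).hasMaximalExponent
  rintro _ ⟨i, rfl⟩
  have hNα : 0 < N ^ α := by positivity
  simp only [Set.mem_ofPred_eq, abs_mul, abs_of_pos hNα, mul_comm (N ^ α)]
  gcongr
  exact hk i

theorem HasMaximalExponent.of_memWeakEll {r : ℝ} (hα : 0 < α) (hr : 0 < r) (hσ : 0 ≤ σ)
    (h : HasMaximalExponent d α γ (fun t : Set.Ioc (0 : ℝ) 1 => (t : ℝ)) σ) {t : ℕ → ℝ}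
    (ht : MemWeakEll r t) : HasMaximalExponent d α γ t (balancedExponent α r σ * σ) := by
  have hunit := h.hasUnitScaleExponent_shortTimes hα.le
  obtain ⟨K, F, hF⟩ := ht.exists_range_subset hα hr hσ
  have hκ : 0 ≤ balancedExponent α r σ := by unfold balancedExponent; positivity
  have hfixed : HasUnitScaleExponent α γ 0 (fun _ => Set.univ) (fun _ => {0}) (annulus d 1) := by
    have := hunit.comp_rpow le_rfl
    rw [zero_mul] at this
    refine this.mono (fun _ => le_rfl) (fun N _ => ?_) le_rfl
    simp [shortTimes]
  have hlarge : HasUnitScaleExponent α γ (balancedExponent α r σ * σ) (fun _ => Set.univ)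
      (fun N => F N) (annulus d 1) := by
    rw [← add_zero (balancedExponent α r σ * σ)]
    refine hfixed.of_translates (fun N hN => (hF N hN).1) fun N _ s hs => ?_
    simpa using hs
  exact (((hunit.comp_rpow hκ).union_times hlarge).mono (fun _ => Set.subset_univ _)
    (fun N hN => (hF N hN).2) le_rfl).hasMaximalExponent

end Sequence

end

theorem proposition3p1 (d : ℕ) (α γ r sStar : ℝ) (hα : 0 < α) (hγ : 0 < γ) (hγd : γ ≤ d)
    (hr : 0 < r) (hs : 0 < sStar)
    (hmax : ∃ C : ℝ, 0 < C ∧ ∀ R : ℝ, 1 ≤ R →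
      ∀ μ : Measure (EuclideanSpace ℝ (Fin d)), IsDimensional γ μ →
      ∀ f : L2Space d, FourierSupportedIn f R →
        maximalNorm α (fun t : Set.Ioc (0 : ℝ) 1 => (t : ℝ)) f μ ≤
          ENNReal.ofReal
            (C * R ^ (((d : ℝ) - γ) / 2 + sStar) * dimConst γ μ ^ ((1 : ℝ) / 2) * ‖f‖))
    (t : ℕ → ℝ) (ht : MemWeakEll r t) :
    ∃ C : ℝ, 0 < C ∧
      ∀ s : ℝ, min sStar (r * α / (r * min α 1 + 2 * sStar) * sStar) ≤ s →
      ∀ R : ℝ, 1 ≤ R →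
      ∀ μ : Measure (EuclideanSpace ℝ (Fin d)), IsDimensional γ μ →
      ∀ f : L2Space d, FourierSupportedIn f R →
        maximalNorm α t f μ ≤
          ENNReal.ofReal
            (C * R ^ (((d : ℝ) - γ) / 2 + s) * dimConst γ μ ^ ((1 : ℝ) / 2) * ‖f‖) := by
  have hmain : HasMaximalExponent d α γ t (min sStar (balancedExponent α r sStar * sStar)) := by
    obtain ⟨k, hk⟩ := ht.exists_abs_le
    rcases min_choice sStar (balancedExponent α r sStar * sStar) with h | h <;> rw [h]
    · exact .of_forall_abs_le hα.le hmax hk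
    · exact .of_memWeakEll hα hr hs.le hmax ht
  obtain ⟨C, hC0, hC⟩ := hmain
  refine ⟨C, hC0, fun s hs R hR μ hμ f hf => (hC R hR μ hμ f hf).trans ?_⟩
  have := dimConst_nonneg γ μ
  gcongr
  exact hs
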